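/- Let $(X,\mathcal X,\mu)$ be a $\sigma$-finite measure space and $(\mathcal E,\mathcal F)$ a symmetric Dirichlet form on the real space $L^2(X,\mu)$, i.e. a densely defined, nonnegative definite, symmetric, closed bilinear form such that $u\in\mathcal F$ implies $(u\vee 0)\wedge 1\in\mathcal F$ and $\mathcal E((u\vee 0)\wedge 1,(u\vee 0)\wedge 1)\le\mathcal E(u,u)$. Let $$\mathcal B=\{f:X\to\mathbb R \text{ bounded and } \mathcal X\text{-measurable}:\ \text{the }\mu\text{-class of } f \text{ is in } \mathcal F\cap L^1(X,\mu)\},$$ which is an algebra of functions under pointwise multiplication, and write $\mathcal E(f,g)$ for the value of the form at the $\mu$-classes of $f,g\in\mathcal B$. Assume the following. (1) There is a function $\chi\in\mathcal B$ that vanishes nowhere on $X$. (Consequently the $\sigma$-ring $\sigma(\mathcal B)$ generated by $\mathcal B$ is a $\sigma$-algebra.) (2) $(\mathcal E,\mathcal F)$ admits a Beurling–Deny decomposition. That is, let $(\mathcal B\otimes\mathcal B)_d$ be the set of all finite sums $F(x,y)=\sum_i f_i(x)g_i(y)$ with $f_i,g_i\in\mathcal B$ and $F(x,x)=0$ for all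 $x\in X$, and let $\sigma((\mathcal B\otimes\mathcal B)_d)$ be the $\sigma$-ring on $X\times X$ generated by it. There are - a symmetric bilinear map $\Gamma_c$ from $\mathcal B\times\mathcal B$ to the finite signed measures on $\sigma(\mathcal B)$ with $\Gamma_c(f,f)\ge 0$ and $\Gamma_c(fg,h)=f\,\Gamma_c(g,h)+g\,\Gamma_c(f,h)$ for all $f,g,h\in\mathcal B$, - a nonnegative measure $J$ on $\sigma((\mathcal B\otimes\mathcal B)_d)$ with $(\mathcal B\otimes\mathcal B)_d\subset L^1(J)$, with $\int F(x,y)\,J(dx\,dy)=\int F(y,x)\,J(dx\,dy)$ for all $F\in(\mathcal B\otimes\mathcal B)_d$, and such that $(x,y)\mapsto(f(x)-f(y))(g(x)-g(y))$ is $J$-integrable for all $f,g\in\mathcal B$, - a nonnegative measure $\kappa$ on $\sigma(\mathcal B)$ with $\mathcal B\subset L^1(\kappa)$, such that for all $f,g\in\mathcal B$ $$\mathcal E(f,g)=\Gamma_c(f,g)(X)+\int_{X\times X}(f(x)-f(y))(g(x)-g(y))\,J(dx\,dy)+\int_X f g\,d\kappa .$$ For $f\in\mathcal B$, the energy measure $\Gamma(f)$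 is the finite nonnegative measure on $\sigma(\mathcal B)$ such that $\mathcal E(fh,f)-\frac12\mathcal E(f^2,h)=\int_X h\,d\Gamma(f)$ for all $h\in\mathcal B$. Let $m$ be a finite measure on $\sigma(\mathcal B)$ that is energy dominant, i.e. $\Gamma(f)\ll m$ for all $f\in\mathcal B$. Then $(\mathcal E,\mathcal B)$ is closable in $L^2(X,m)=L^2(X,\sigma(\mathcal B),m)$: we have $\mathcal B\subset L^2(X,m)$, and if $u_n\in\mathcal B$, $\mathcal E(u_n-u_k,u_n-u_k)\to 0$ as $n,k\to\infty$, and $u_n\to 0$ in $L^2(X,m)$, then $\mathcal E(u_n,u_n)\to 0$. Moreover, its closure $(\mathcal E,\mathcal F^{(m)})$ is a symmetric Dirichlet form on $L^2(X,m)$. Here $\mathcal F^{(m)}$ is the set of all $L^2(X,m)$-limits of $\mathcal E$-Cauchy sequences in $\mathcal B$, and $\mathcal E(u,v)=\lim_n\mathcal E(f_n,g_n)$ for $\mathcal E$-Cauchy sequences $(f_n),(g_n)$ in $\mathcal B$ with $f_n\to u$ and $g_n\to v$ in $L^2(X,m)$. -/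

import Mathlib

open MeasureTheory Filter Topology

/-- A symmetric Dirichlet form `(form, domain)` on the real Hilbert space `L²(X, μ)`: a densely
defined, nonnegative definite, symmetric bilinear form that is closed and Markovian. -/
structure DirichletForm {X : Type*} {mX : MeasurableSpace X} (μ : Measure X) where
  /-- the domain, a linear subspace of `L²(X, μ)` -/
  domain : Submodule ℝ (Lp ℝ 2 μ)
  /-- the bilinear form on the domain -/
  form : domain →ₗ[ℝ] domain →ₗ[ℝ] ℝ
  dense : Dense (domain : Set (Lp ℝ 2 μ))
  symm : ∀ u v : domain, form u v = form v u
  nonneg : ∀ u : domain, 0 ≤ form u u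
  /-- closedness: if `u n → v` in `L²(X, μ)` and `u` is Cauchy for the form, then `v` lies in the
  domain and `u n → v` for the form -/
  closed : ∀ (u : ℕ → domain) (v : Lp ℝ 2 μ),
    (∀ ε > 0, ∃ N, ∀ i ≥ N, ∀ j ≥ N, form (u i - u j) (u i - u j) < ε) →
    Tendsto (fun n => (u n : Lp ℝ 2 μ)) atTop (𝓝 v) →
    ∃ hv : v ∈ domain,
      Tendsto (fun n => form (u n - ⟨v, hv⟩) (u n - ⟨v, hv⟩)) atTop (𝓝 0)
  /-- Markov property: the unit contraction `t ↦ (t ∨ 0) ∧ 1` operates -/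
  markov : ∀ u : domain, ∃ v : domain,
    ((v : Lp ℝ 2 μ) : X → ℝ) =ᵐ[μ] (fun x => min (max (((u : Lp ℝ 2 μ) : X → ℝ) x) 0) 1) ∧
    form v v ≤ form u u

/-! ### Bilinear forms on spaces of functions, closability and closure -/

/-- `u` is a Cauchy sequence for the (squared) seminorm `f ↦ E f f`. -/
def FormCauchy {Y : Type*} (E : (Y → ℝ) → (Y → ℝ) → ℝ) (u : ℕ → Y → ℝ) : Prop :=
  ∀ ε > 0, ∃ N, ∀ i ≥ N, ∀ j ≥ N, E (u i - u j) (u i - u j) < ε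

/-- `(E, V)`, with `V` a space of functions, is closable in `L²(Y, m)`: all elements of `V` are
square integrable, and `E (u n) (u n) → 0` for every `E`-Cauchy sequence `u` in `V` that
converges to zero in `L²(Y, m)`. (For constant sequences: `E f f = 0` if `f = 0` `m`-a.e.) -/
def IsClosableIn {Y : Type*} {mY : MeasurableSpace Y} (m : Measure Y)
    (V : Set (Y → ℝ)) (E : (Y → ℝ) → (Y → ℝ) → ℝ) : Prop :=
  (∀ f ∈ V, MemLp f 2 m) ∧
  ∀ u : ℕ → Y → ℝ, (∀ n, u n ∈ V) → FormCauchy E u →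
    Tendsto (fun n => eLpNorm (u n) 2 m) atTop (𝓝 0) →
    Tendsto (fun n => E (u n) (u n)) atTop (𝓝 0)

/-- `u` is an `E`-Cauchy sequence in `V` that converges to `v` in `L²(Y, m)`. -/
def IsApproximating {Y : Type*} {mY : MeasurableSpace Y} (m : Measure Y)
    (V : Set (Y → ℝ)) (E : (Y → ℝ) → (Y → ℝ) → ℝ) (u : ℕ → Y → ℝ) (v : Lp ℝ 2 m) : Prop :=
  (∀ n, u n ∈ V) ∧ FormCauchy E u ∧
    Tendsto (fun n => eLpNorm (u n - (v : Y → ℝ)) 2 m) atTop (𝓝 0)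

/-- The form `D` on `L²(Y, m)` is the closure of `(E, V)`: its domain consists of the `L²(Y, m)`-limits
of `E`-Cauchy sequences in `V`, and its values are the limits of `E` along such sequences. -/
def DirichletForm.IsClosureOf {Y : Type*} {mY : MeasurableSpace Y} {m : Measure Y}
    (D : DirichletForm m) (V : Set (Y → ℝ)) (E : (Y → ℝ) → (Y → ℝ) → ℝ) : Prop :=
  (∀ v : Lp ℝ 2 m, v ∈ D.domain ↔ ∃ u, IsApproximating m V E u v) ∧
  ∀ (v w : D.domain) (f g : ℕ → Y → ℝ),
    IsApproximating m V E f v → IsApproximating m V E g w →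
    Tendsto (fun n => E (f n) (g n)) atTop (𝓝 (D.form v w))

namespace DirichletForm

variable {X : Type*} {mX : MeasurableSpace X} {μ : Measure X}

/-- The `μ`-equivalence class of `f` belongs to the domain of the form. -/
def InDomain (D : DirichletForm μ) (f : X → ℝ) : Prop :=
  ∃ hf : MemLp f 2 μ, hf.toLp f ∈ D.domain

open Classical in
/-- The form evaluated on the `μ`-equivalence classes of two functions (with the value `0`
unless both classes are in the domain). -/
noncomputable def energy (D : DirichletForm μ) (f g : X → ℝ) : ℝ :=
  if h : D.InDomain f ∧ D.InDomain g then
    D.form ⟨h.1.choose.toLp f, h.1.choose_spec⟩ ⟨h.2.choose.toLp g, h.2.choose_spec⟩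
  else 0

/-- The space `ℬ` of all bounded measurable functions on `X` (functions, not classes) whose
`μ`-equivalence class is in the domain of the form and in `L¹(X, μ)`. -/
def boundedAlgebra (D : DirichletForm μ) : Set (X → ℝ) :=
  {f | Measurable f ∧ (∃ C, ∀ x, |f x| ≤ C) ∧ Integrable f μ ∧ D.InDomain f}

/-- The σ-algebra `σ(ℬ)` on `X` generated by `ℬ`. If some function in `ℬ` vanishes nowhere, then
this is also the σ-ring generated by `ℬ`. -/
def sigmaB (D : DirichletForm μ) : MeasurableSpace X :=
  ⨆ f ∈ D.boundedAlgebra, MeasurableSpace.comap f inferInstance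

/-- The functions `∑ i, f i ⊗ g i` in `ℬ ⊗ ℬ` on `X × X` that vanish on the diagonal. -/
def tensorDiag (D : DirichletForm μ) : Set (X × X → ℝ) :=
  {F | (∃ (n : ℕ) (f g : Fin n → X → ℝ),
      (∀ i, f i ∈ D.boundedAlgebra) ∧ (∀ i, g i ∈ D.boundedAlgebra) ∧
      ∀ p : X × X, F p = ∑ i, f i p.1 * g i p.2) ∧
    ∀ x, F (x, x) = 0}

/-- The σ-algebra on `X × X` generated by the functions in `(ℬ ⊗ ℬ)_d`. Its elements are the sets
of the σ-ring generated by `(ℬ ⊗ ℬ)_d` and their complements; every measure on this σ-ring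
extends to it, and the integrals of functions that are measurable for the σ-ring do not depend on
the extension. -/
def sigmaTensorDiag (D : DirichletForm μ) : MeasurableSpace (X × X) :=
  ⨆ F ∈ D.tensorDiag, MeasurableSpace.comap F inferInstance

/-- `(Γc, J, κ)` is a Beurling–Deny decomposition of the form. The values of `Γc` at pairs of
functions outside of `ℬ` are irrelevant. -/
structure IsBeurlingDeny (D : DirichletForm μ)
    (Γc : (X → ℝ) → (X → ℝ) → @SignedMeasure X D.sigmaB)
    (J : Measure[D.sigmaTensorDiag] (X × X)) (κ : Measure[D.sigmaB] X) : Prop where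
  /-- `Γc` is symmetric and bilinear on `ℬ` -/
  local_symm : ∀ f ∈ D.boundedAlgebra, ∀ g ∈ D.boundedAlgebra, Γc f g = Γc g f
  local_add : ∀ f ∈ D.boundedAlgebra, ∀ g ∈ D.boundedAlgebra, ∀ h ∈ D.boundedAlgebra,
    Γc (f + g) h = Γc f h + Γc g h
  local_smul : ∀ (c : ℝ), ∀ f ∈ D.boundedAlgebra, ∀ h ∈ D.boundedAlgebra,
    Γc (c • f) h = c • Γc f h
  /-- `Γc f f` is a nonnegative measure -/
  local_nonneg : ∀ f ∈ D.boundedAlgebra, ∀ A, 0 ≤ Γc f f A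
  /-- the product rule `Γc (f g, h) = f Γc (g, h) + g Γc (f, h)` -/
  local_mul : ∀ f ∈ D.boundedAlgebra, ∀ g ∈ D.boundedAlgebra, ∀ h ∈ D.boundedAlgebra,
    Γc (f * g) h =
      (Γc g h).withDensity f (ContinuousLinearMap.lsmul ℝ ℝ) +
      (Γc f h).withDensity g (ContinuousLinearMap.lsmul ℝ ℝ)
  jump_integrable : ∀ F ∈ D.tensorDiag, Integrable F J
  jump_symm : ∀ F ∈ D.tensorDiag, ∫ p, F p ∂J = ∫ p, F p.swap ∂J
  /-- the signed measures `A ↦ ∫∫ 1_A(x) (f x - f y) (g x - g y) J(dx dy)` exist and are finite -/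
  jump_finite : ∀ f ∈ D.boundedAlgebra, ∀ g ∈ D.boundedAlgebra,
    Integrable (fun p : X × X => (f p.1 - f p.2) * (g p.1 - g p.2)) J
  kill_integrable : ∀ f ∈ D.boundedAlgebra, Integrable f κ
  /-- the form is the sum of the total masses of the local, the jump and the killing part -/
  decomp : ∀ f ∈ D.boundedAlgebra, ∀ g ∈ D.boundedAlgebra,
    D.energy f g = Γc f g Set.univ
      + ∫ p, (f p.1 - f p.2) * (g p.1 - g p.2) ∂J
      + ∫ x, f x * g x ∂κ

/-- The form admits a Beurling–Deny decomposition. -/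
def HasBeurlingDeny (D : DirichletForm μ) : Prop :=
  ∃ Γc J κ, D.IsBeurlingDeny Γc J κ

/-- `ν` is the energy measure `Γ(f)` of `f`: the finite measure on `σ(ℬ)` such that
`E(f h, f) - E(f², h) / 2 = ∫ h dΓ(f)` for all `h ∈ ℬ`. -/
def IsEnergyMeasure (D : DirichletForm μ) (f : X → ℝ) (ν : Measure[D.sigmaB] X) : Prop :=
  IsFiniteMeasure ν ∧ ∀ h ∈ D.boundedAlgebra,
    D.energy (f * h) f - 1 / 2 * D.energy (f * f) h = ∫ x, h x ∂ν

/-- A measure `m` on `σ(ℬ)` is energy dominant if the energy measures of all `f ∈ ℬ` are absolutely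
continuous with respect to `m`. -/
def EnergyDominant (D : DirichletForm μ) (m : Measure[D.sigmaB] X) : Prop :=
  ∀ f ∈ D.boundedAlgebra, ∀ ν : Measure[D.sigmaB] X, D.IsEnergyMeasure f ν → ν ≪ m

end DirichletForm

/-! Let `u n` be `E`-Cauchy and tend to zero in `L²(m)`. A Cauchy sequence with a subsequence of
vanishing energy has vanishing energy itself, so one may assume `u n → 0` `m`-a.e.

Energy dominance transfers this convergence to every part of the form. By the Leibniz rule the
energy measure of `f` is `Γc(f,f)`, plus half the sum of the two marginals of `(f x - f y)² J`, plus
`½ f² κ` (`energy_identity`, `exists_energyMeasure`). Hence an `m`-null set is null for `Γc(f,f)`,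
and it is charged neither by `κ` on `{f ≠ 0}` nor by the marginals of `J` on `{f x ≠ f y}`. The jump
and killing energies of `u n` therefore tend to zero by Fatou's lemma (`jump_kill_tendsto`).

The local part has no such pointwise expression and is reduced to the closedness of the original
form in `L²(μ)`. First, `u n` is composed with polynomials `p` with `p 0 = 0` and `p' 0 = 1` that
are uniformly small on the range of `u n`. The chain rule gives `Γc(p(u) - u) = (p'(u) - 1)² Γc(u)`,
whose weight tends to zero; so along a subsequence `u n` is replaced, up to vanishing energy, by `v
n → 0` uniformly (`exists_uniform`). Next, `χ v n` is Cauchy and is bounded by `|χ| / (n + 1)` with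
`χ ∈ L²(μ)`, so it tends to zero in `L²(μ)` and closedness gives `E(χ v n) → 0`
(`tendsto_energyForm_zero`). The Leibniz rule yields `χ² Γc(v) ≤ 2 Γc(χ v) + 2 v² Γc(χ)`, and since
`χ` vanishes nowhere the local energy of `v n` itself tends to zero (`local_tendsto_of_weighted`).
These steps are assembled in `tendsto_energy_zero`.

The closure inherits the Markov property because truncations of an approximating sequence have
bounded energy, so suitable convex combinations of them are Cauchy (`exists_qCauchy_tendsto`). It is
densely defined because indicators of the sets `{f > 0}` are limits of truncations of `n f`, and
these sets form a generating π-system (`dense_range_toL2`). -/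

/-! ### Positive forms, Cauchy sequences and convex combinations -/

section PosSemidefForm

variable {V H : Type*} [AddCommGroup V] [Module ℝ V]

/-- A sequence is Cauchy for the quadratic form `v ↦ Q v v`. -/
def QCauchy (Q : V →ₗ[ℝ] V →ₗ[ℝ] ℝ) (u : ℕ → V) : Prop :=
  ∀ ε > 0, ∃ N, ∀ i ≥ N, ∀ j ≥ N, Q (u i - u j) (u i - u j) < ε

/-- A symmetric nonnegative definite bilinear form. -/
structure IsPosForm (Q : V →ₗ[ℝ] V →ₗ[ℝ] ℝ) : Prop where
  symm : ∀ u v, Q u v = Q v u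
  nonneg : ∀ u, 0 ≤ Q u u

variable {Q : V →ₗ[ℝ] V →ₗ[ℝ] ℝ}

namespace IsPosForm

theorem sq_le (hQ : IsPosForm Q) (u v : V) : Q u v ^ 2 ≤ Q u u * Q v v := by
  have h : ∀ t : ℝ, 0 ≤ Q v v * (t * t) + 2 * Q u v * t + Q u u := by
    intro t
    have := hQ.nonneg (u + t • v)
    simp only [map_add, LinearMap.add_apply, map_smul, LinearMap.smul_apply, smul_eq_mul,
      hQ.symm v u] at this
    nlinarith
  have := discrim_le_zero h
  rw [discrim] at this
  nlinarith

/-- The seminorm `√(Q v v)`. -/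
noncomputable def seminorm (hQ : IsPosForm Q) : Seminorm ℝ V :=
  Seminorm.of (fun v => √(Q v v))
    (fun u v => by
      have h1 : Q u v ≤ √(Q u u) * √(Q v v) := by
        rw [← Real.sqrt_mul (hQ.nonneg u)]
        exact Real.le_sqrt_of_sq_le (hQ.sq_le u v)
      apply Real.sqrt_le_iff.2 ⟨by positivity, ?_⟩
      simp only [map_add, LinearMap.add_apply, hQ.symm v u]
      nlinarith [Real.sq_sqrt (hQ.nonneg u), Real.sq_sqrt (hQ.nonneg v)])
    (fun a v => by
      simp only [map_smul, LinearMap.smul_apply, smul_eq_mul, Real.norm_eq_abs]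
      rw [← mul_assoc, Real.sqrt_mul (mul_self_nonneg a), Real.sqrt_mul_self_eq_abs])

theorem seminorm_sq (hQ : IsPosForm Q) (v : V) : hQ.seminorm v ^ 2 = Q v v :=
  Real.sq_sqrt (hQ.nonneg v)

theorem abs_le (hQ : IsPosForm Q) (u v : V) : |Q u v| ≤ hQ.seminorm u * hQ.seminorm v := by
  apply abs_le_of_sq_le_sq _ (by positivity)
  rw [mul_pow, hQ.seminorm_sq, hQ.seminorm_sq]
  exact hQ.sq_le u v

theorem add_le (hQ : IsPosForm Q) (u v : V) : Q (u + v) (u + v) ≤ 2 * Q u u + 2 * Q v v := by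
  have := hQ.nonneg (u - v)
  simp only [map_add, map_sub, LinearMap.add_apply, LinearMap.sub_apply] at this ⊢
  linarith

theorem sub_le (hQ : IsPosForm Q) (u v : V) : Q (u - v) (u - v) ≤ 2 * Q u u + 2 * Q v v := by
  simpa [sub_eq_add_neg] using hQ.add_le u (-v)

theorem sub_comm (Q : V →ₗ[ℝ] V →ₗ[ℝ] ℝ) (u v : V) : Q (u - v) (u - v) = Q (v - u) (v - u) := by
  rw [← neg_sub v u]
  simp only [map_neg, LinearMap.neg_apply, neg_neg]

theorem smul_smul (Q : V →ₗ[ℝ] V →ₗ[ℝ] ℝ) (c : ℝ) (v : V) : Q (c • v) (c • v) = c ^ 2 * Q v v := by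
  simp only [map_smul, LinearMap.smul_apply, smul_eq_mul]
  ring

theorem convex_le (hQ : IsPosForm Q) (C : ℝ) : Convex ℝ {v | Q v v ≤ C} := by
  by_cases hC : 0 ≤ C
  · have : {v | Q v v ≤ C} = hQ.seminorm.closedBall 0 (√C) := by
      ext v
      rw [Seminorm.mem_closedBall_zero, Set.mem_ofPred_eq, ← hQ.seminorm_sq]
      exact (Real.le_sqrt (apply_nonneg _ _) hC).symm
    rw [this]
    exact Seminorm.convex_closedBall _ _ _
  · convert convex_empty
    ext v
    simpa using (not_le.1 hC).trans_le (hQ.nonneg v)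

theorem sum_le (hQ : IsPosForm Q) {C : ℝ} (hC : 0 ≤ C) (n : ℕ) (x : ℕ → V)
    (hx : ∀ k < n, Q (x k) (x k) ≤ C) :
    Q (∑ k ∈ Finset.range n, x k) (∑ k ∈ Finset.range n, x k) ≤ n ^ 2 * C := by
  rw [← hQ.seminorm_sq, ← Real.sq_sqrt hC, ← mul_pow]
  refine pow_le_pow_left₀ (apply_nonneg _ _) ?_ 2
  refine (Finset.le_sum_of_subadditive hQ.seminorm (map_zero _).le (map_add_le_add _) _ _).trans ?_
  refine (Finset.sum_le_card_nsmul _ _ (√C) fun k hk => ?_).trans (by simp)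
  exact Real.sqrt_le_sqrt (hx k (Finset.mem_range.1 hk))

end IsPosForm

namespace QCauchy

theorem iff_seminorm (hQ : IsPosForm Q) {u : ℕ → V} :
    QCauchy Q u ↔ ∀ ε > 0, ∃ N, ∀ i ≥ N, ∀ j ≥ N, hQ.seminorm (u i - u j) < ε := by
  constructor
  · intro h ε hε
    obtain ⟨N, hN⟩ := h (ε ^ 2) (by positivity)
    refine ⟨N, fun i hi j hj => ?_⟩
    have := hN i hi j hj
    rw [← hQ.seminorm_sq] at this
    exact lt_of_pow_lt_pow_left₀ 2 hε.le this
  · intro h ε hε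
    obtain ⟨N, hN⟩ := h (√ε) (by positivity)
    refine ⟨N, fun i hi j hj => ?_⟩
    rw [← hQ.seminorm_sq, ← Real.sq_sqrt hε.le]
    exact pow_lt_pow_left₀ (hN i hi j hj) (apply_nonneg _ _) two_ne_zero

theorem of_le {u : ℕ → V} (δ : ℕ → ℝ) (hδ : Tendsto δ atTop (𝓝 0))
    (h : ∀ i j, i ≤ j → Q (u i - u j) (u i - u j) ≤ δ i) : QCauchy Q u := by
  intro ε hε
  obtain ⟨N, hN⟩ := eventually_atTop.1 (hδ.eventually_lt_const hε)
  refine ⟨N, fun i hi j hj => ?_⟩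
  rcases le_total i j with hij | hij
  · exact (h i j hij).trans_lt (hN i hi)
  · rw [IsPosForm.sub_comm]
    exact (h j i hij).trans_lt (hN j hj)

theorem add (hQ : IsPosForm Q) {u v : ℕ → V} (hu : QCauchy Q u) (hv : QCauchy Q v) :
    QCauchy Q (u + v) := by
  intro ε hε
  obtain ⟨N, hN⟩ := hu (ε / 4) (by positivity)
  obtain ⟨M, hM⟩ := hv (ε / 4) (by positivity)
  refine ⟨max N M, fun i hi j hj => ?_⟩
  have h1 := hN i (le_trans (le_max_left _ _) hi) j (le_trans (le_max_left _ _) hj)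
  have h2 := hM i (le_trans (le_max_right _ _) hi) j (le_trans (le_max_right _ _) hj)
  have h3 := hQ.add_le (u i - u j) (v i - v j)
  have h4 : (u + v) i - (u + v) j = u i - u j + (v i - v j) := by
    simp only [Pi.add_apply]; abel
  rw [h4]
  linarith

theorem smul {u : ℕ → V} (hu : QCauchy Q u) (c : ℝ) : QCauchy Q (c • u) := by
  intro ε hε
  obtain ⟨N, hN⟩ := hu (ε / (c ^ 2 + 1)) (by positivity)
  refine ⟨N, fun i hi j hj => ?_⟩
  have h1 := hN i hi j hj
  have h4 : (c • u) i - (c • u) j = c • (u i - u j) := by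
    simp only [Pi.smul_apply, smul_sub]
  rw [h4]
  simp only [map_smul, LinearMap.smul_apply, smul_eq_mul]
  rw [lt_div_iff₀ (by positivity)] at h1
  by_cases hc : Q (u i - u j) (u i - u j) ≤ 0
  · nlinarith [sq_nonneg c]
  · nlinarith [sq_nonneg c]

theorem sub (hQ : IsPosForm Q) {u v : ℕ → V} (hu : QCauchy Q u) (hv : QCauchy Q v) :
    QCauchy Q (u - v) := by
  have : u - v = u + (-1 : ℝ) • v := by simp [sub_eq_add_neg]
  rw [this]
  exact hu.add hQ (hv.smul _)

theorem const (Q : V →ₗ[ℝ] V →ₗ[ℝ] ℝ) (v : V) : QCauchy Q fun _ => v :=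
  fun ε hε => ⟨0, fun _ _ _ _ => by simpa using hε⟩

theorem comp {u : ℕ → V} (hu : QCauchy Q u) {ns : ℕ → ℕ} (hns : Tendsto ns atTop atTop) :
    QCauchy Q (u ∘ ns) := by
  intro ε hε
  obtain ⟨N, hN⟩ := hu ε hε
  obtain ⟨M, hM⟩ := eventually_atTop.1 (hns.eventually_ge_atTop N)
  exact ⟨M, fun i hi j hj => hN _ (hM i hi) _ (hM j hj)⟩

theorem bounded (hQ : IsPosForm Q) {u : ℕ → V} (hu : QCauchy Q u) :
    ∃ C, 0 ≤ C ∧ ∀ n, hQ.seminorm (u n) ≤ C := by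
  obtain ⟨N, hN⟩ := (iff_seminorm hQ).1 hu 1 one_pos
  refine ⟨∑ k ∈ Finset.range (N + 1), hQ.seminorm (u k) + 1, by positivity, fun n => ?_⟩
  have hle : ∀ k ≤ N, hQ.seminorm (u k) ≤ ∑ k ∈ Finset.range (N + 1), hQ.seminorm (u k) :=
    fun k hk => Finset.single_le_sum (f := fun k => hQ.seminorm (u k))
      (fun _ _ => apply_nonneg _ _) (by simpa [Nat.lt_succ_iff] using hk)
  rcases le_total n N with h | h
  · linarith [hle n h]
  · have h1 := hN n h N le_rfl
    have h2 : hQ.seminorm (u n) ≤ hQ.seminorm (u n - u N) + hQ.seminorm (u N) := by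
      simpa using map_add_le_add hQ.seminorm (u n - u N) (u N)
    linarith [hle N le_rfl]

/-- If a Cauchy sequence tends to zero along arbitrarily late terms then it tends to zero. -/
theorem tendsto_zero_of_subseq (hQ : IsPosForm Q) {u : ℕ → V} (hu : QCauchy Q u) {ns : ℕ → ℕ}
    (hns : Tendsto ns atTop atTop)
    (h : Tendsto (fun n => Q (u (ns n)) (u (ns n))) atTop (𝓝 0)) :
    Tendsto (fun n => Q (u n) (u n)) atTop (𝓝 0) := by
  rw [Metric.tendsto_atTop]
  intro ε hε
  obtain ⟨N, hN⟩ := hu (ε / 4) (by positivity)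
  obtain ⟨k, hk1, hk2⟩ :=
    ((hns.eventually_ge_atTop N).and (h.eventually_lt_const (show 0 < ε / 4 by positivity))).exists
  refine ⟨N, fun n hn => ?_⟩
  rw [Real.dist_eq, sub_zero, abs_of_nonneg (hQ.nonneg _)]
  have h1 := hN n hn _ hk1
  have h2 := hQ.add_le (u n - u (ns k)) (u (ns k))
  rw [sub_add_cancel] at h2
  linarith

end QCauchy

/-- Almost minimal elements of the convex hulls of the tails form a Cauchy sequence, by the
parallelogram identity, since the infima increase to a finite limit. This replaces weak compactness
and needs no completeness. -/
theorem exists_qCauchy_mem_convexHull (hQ : IsPosForm Q) (x : ℕ → V) {M : ℝ}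
    (hM : ∀ n, Q (x n) (x n) ≤ M) :
    ∃ y : ℕ → V, (∀ n, y n ∈ convexHull ℝ (x '' Set.Ici n)) ∧ QCauchy Q y := by
  set K : ℕ → Set V := fun n => convexHull ℝ (x '' Set.Ici n)
  have hK : ∀ n k, n ≤ k → K k ⊆ K n := fun n k h =>
    convexHull_mono (Set.image_mono (Set.Ici_subset_Ici.2 h))
  have hxK : ∀ n, x n ∈ K n := fun n => subset_convexHull _ _ ⟨n, Set.self_mem_Ici, rfl⟩
  set d : ℕ → ℝ := fun n => sInf ((fun v => Q v v) '' K n)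
  have hbdd : ∀ n, BddBelow ((fun v => Q v v) '' K n) := fun n =>
    ⟨0, by rintro _ ⟨v, -, rfl⟩; exact hQ.nonneg v⟩
  have hd : ∀ n, ∀ v ∈ K n, d n ≤ Q v v := fun n v hv => csInf_le (hbdd n) ⟨v, hv, rfl⟩
  have hmono : Monotone d := fun n k h =>
    csInf_le_csInf (hbdd n) ⟨_, ⟨x k, hxK k, rfl⟩⟩ (Set.image_mono (hK n k h))
  have hdM : ∀ n, d n ≤ M := fun n => (hd n _ (hxK n)).trans (hM n)
  have hlim : Tendsto d atTop (𝓝 (⨆ n, d n)) :=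
    tendsto_atTop_ciSup hmono ⟨M, by rintro _ ⟨n, rfl⟩; exact hdM n⟩
  have hsup : ∀ n, d n ≤ ⨆ n, d n := fun n =>
    le_ciSup (f := d) ⟨M, by rintro _ ⟨n, rfl⟩; exact hdM n⟩ n
  have hex : ∀ n : ℕ, ∃ v ∈ K n, Q v v < d n + 1 / (n + 1 : ℝ) := by
    intro n
    obtain ⟨_, ⟨v, hv, rfl⟩, h⟩ := exists_lt_of_csInf_lt (⟨_, ⟨x n, hxK n, rfl⟩⟩ :
      ((fun v => Q v v) '' K n).Nonempty) (show d n < d n + 1 / (n + 1 : ℝ) by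
        have : (0 : ℝ) < 1 / (n + 1 : ℝ) := by positivity
        linarith)
    exact ⟨v, hv, h⟩
  choose y hyK hy using hex
  refine ⟨y, hyK, QCauchy.of_le (fun n => 2 * ((⨆ n, d n) - d n) + 4 * (1 / (n + 1 : ℝ))) ?_ ?_⟩
  · have h1 := (tendsto_const_nhds (x := ⨆ n, d n)).sub hlim
    simpa using (h1.const_mul 2).add (tendsto_one_div_add_atTop_nhds_zero_nat.const_mul 4)
  -- The midpoint lies in `K n`, so its energy is at least `d n`; the parallelogram identity then
  -- bounds `Q (y n - y k)` by `2 Q (y n) + 2 Q (y k) - 4 d n`.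
  · intro n k hnk
    have hmid : (1 / 2 : ℝ) • y n + (1 / 2 : ℝ) • y k ∈ K n :=
      convex_convexHull ℝ _ (hyK n) (hK n k hnk (hyK k)) (by norm_num) (by norm_num) (by norm_num)
    have h1 := hd n _ hmid
    have h2 := hy n
    have h3 := hy k
    have h4 := hsup k
    have h5 : 1 / (k + 1 : ℝ) ≤ 1 / (n + 1 : ℝ) := by gcongr
    simp only [map_add, map_sub, LinearMap.add_apply, LinearMap.sub_apply, map_smul,
      LinearMap.smul_apply, smul_eq_mul] at h1 ⊢
    linarith

/-- A sequence that is bounded for `Q` and whose images converge has convex combinations that are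
Cauchy for `Q`, with the same limit. -/
theorem exists_qCauchy_tendsto [NormedAddCommGroup H] [NormedSpace ℝ H] (hQ : IsPosForm Q)
    (T : V →ₗ[ℝ] H) (x : ℕ → V)
    {c : ℕ → ℝ} {C : ℝ} (hx : ∀ n, Q (x n) (x n) ≤ c n) (hc : Tendsto c atTop (𝓝 C))
    {h : H} (hT : Tendsto (fun n => T (x n)) atTop (𝓝 h)) :
    ∃ y : ℕ → V, QCauchy Q y ∧ Tendsto (fun n => T (y n)) atTop (𝓝 h) ∧
      ∀ ε > 0, ∀ᶠ n in atTop, Q (y n) (y n) ≤ C + ε := by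
  obtain ⟨M, hM⟩ := hc.bddAbove_range
  obtain ⟨y, hyK, hy⟩ := exists_qCauchy_mem_convexHull hQ x
    (fun n => (hx n).trans (hM ⟨n, rfl⟩))
  refine ⟨y, hy, ?_, ?_⟩
  · rw [Metric.tendsto_atTop] at hT ⊢
    intro ε hε
    obtain ⟨N, hN⟩ := hT ε hε
    refine ⟨N, fun n hn => ?_⟩
    have hsub : x '' Set.Ici n ⊆ T ⁻¹' Metric.ball h ε := by
      rintro _ ⟨k, hk, rfl⟩
      exact hN k (le_trans hn hk)
    exact convexHull_min hsub ((convex_ball h ε).is_linear_preimage T.isLinear) (hyK n)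
  · intro ε hε
    obtain ⟨N, hN⟩ := eventually_atTop.1 (hc.eventually_le_const (show C < C + ε by linarith))
    filter_upwards [eventually_ge_atTop N] with n hn
    refine convexHull_min ?_ (hQ.convex_le (C + ε)) (hyK n)
    rintro _ ⟨k, hk, rfl⟩
    exact (hx k).trans (hN k (le_trans hn hk))

end PosSemidefForm

/-! ### The abstract closure of a closable form -/

section Closure

variable {V H : Type*} [AddCommGroup V] [Module ℝ V] [NormedAddCommGroup H] [NormedSpace ℝ H]

/-- `u` is Cauchy for `Q` and its image under `T` converges to `h`. -/
def QApprox (Q : V →ₗ[ℝ] V →ₗ[ℝ] ℝ) (T : V →ₗ[ℝ] H) (u : ℕ → V) (h : H) : Prop :=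
  QCauchy Q u ∧ Tendsto (fun n => T (u n)) atTop (𝓝 h)

/-- Closability of `Q` with respect to the map `T`. -/
def QClosable (Q : V →ₗ[ℝ] V →ₗ[ℝ] ℝ) (T : V →ₗ[ℝ] H) : Prop :=
  ∀ u, QApprox Q T u 0 → Tendsto (fun n => Q (u n) (u n)) atTop (𝓝 0)

variable {Q : V →ₗ[ℝ] V →ₗ[ℝ] ℝ} {T : V →ₗ[ℝ] H}

namespace QApprox

theorem add (hQ : IsPosForm Q) {u v : ℕ → V} {h k : H} (hu : QApprox Q T u h)
    (hv : QApprox Q T v k) : QApprox Q T (u + v) (h + k) :=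
  ⟨hu.1.add hQ hv.1, by simpa using hu.2.add hv.2⟩

theorem sub (hQ : IsPosForm Q) {u v : ℕ → V} {h k : H} (hu : QApprox Q T u h)
    (hv : QApprox Q T v k) : QApprox Q T (u - v) (h - k) :=
  ⟨hu.1.sub hQ hv.1, by simpa using hu.2.sub hv.2⟩

theorem smul {u : ℕ → V} {h : H} (hu : QApprox Q T u h) (c : ℝ) :
    QApprox Q T (c • u) (c • h) :=
  ⟨hu.1.smul c, by simpa using hu.2.const_smul c⟩

theorem const (Q : V →ₗ[ℝ] V →ₗ[ℝ] ℝ) (T : V →ₗ[ℝ] H) (v : V) :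
    QApprox Q T (fun _ => v) (T v) :=
  ⟨QCauchy.const Q v, tendsto_const_nhds⟩

/-- Limits of the form do not depend on the approximating sequences. Write the difference as `Q (f -
f') g + Q f' (g - g')`: closability makes the energies of `f - f'` and `g - g'` vanish, and Cauchy
sequences are bounded for the seminorm. -/
theorem tendsto_sub (hQ : IsPosForm Q) (hcl : QClosable Q T) {f f' g g' : ℕ → V} {v w : H}
    (hf : QApprox Q T f v) (hf' : QApprox Q T f' v) (hg : QApprox Q T g w)
    (hg' : QApprox Q T g' w) :
    Tendsto (fun n => Q (f n) (g n) - Q (f' n) (g' n)) atTop (𝓝 0) := by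
  have key : ∀ {a b c : ℕ → V} {v : H}, QApprox Q T a v → QApprox Q T b v → QCauchy Q c →
      Tendsto (fun n => Q (a n - b n) (c n)) atTop (𝓝 0) := by
    intro a b c v ha hb hc
    have h0 : Tendsto (fun n => hQ.seminorm (a n - b n)) atTop (𝓝 0) := by
      have := hcl (a - b) (by simpa using ha.sub hQ hb)
      have := (Real.continuous_sqrt.tendsto 0).comp this
      rwa [Real.sqrt_zero] at this
    obtain ⟨C, -, hC⟩ := hc.bounded hQ
    refine squeeze_zero_norm (fun n => ?_) (by simpa using h0.mul_const C)
    exact (hQ.abs_le _ _).trans (mul_le_mul_of_nonneg_left (hC n) (apply_nonneg _ _))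
  have h := (key hf hf' hg.1).add (key hg hg' hf'.1)
  simp only [map_sub, LinearMap.sub_apply, add_zero] at h
  refine h.congr fun n => ?_
  rw [hQ.symm (g n), hQ.symm (g' n)]
  ring

theorem exists_tendsto (hQ : IsPosForm Q) {f g : ℕ → V}
    (hf : QCauchy Q f) (hg : QCauchy Q g) : ∃ a, Tendsto (fun n => Q (f n) (g n)) atTop (𝓝 a) := by
  apply cauchySeq_tendsto_of_complete
  obtain ⟨C, hC0, hC⟩ := hf.bounded hQ
  obtain ⟨D, hD0, hD⟩ := hg.bounded hQ
  rw [Metric.cauchySeq_iff]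
  intro ε hε
  obtain ⟨N, hN⟩ := (QCauchy.iff_seminorm hQ).1 hf (ε / (2 * (D + 1))) (by positivity)
  obtain ⟨M, hM⟩ := (QCauchy.iff_seminorm hQ).1 hg (ε / (2 * (C + 1))) (by positivity)
  refine ⟨max N M, fun i hi j hj => ?_⟩
  have h1 := hN i (le_trans (le_max_left _ _) hi) j (le_trans (le_max_left _ _) hj)
  have h2 := hM i (le_trans (le_max_right _ _) hi) j (le_trans (le_max_right _ _) hj)
  rw [lt_div_iff₀ (by positivity)] at h1 h2
  have h3 := hQ.abs_le (f i - f j) (g i)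
  have h4 := hQ.abs_le (f j) (g i - g j)
  have h5 : Q (f i) (g i) - Q (f j) (g j) = Q (f i - f j) (g i) + Q (f j) (g i - g j) := by
    simp only [map_sub, LinearMap.sub_apply]; ring
  rw [Real.dist_eq, h5]
  have h6 := abs_add_le (Q (f i - f j) (g i)) (Q (f j) (g i - g j))
  have h7 : hQ.seminorm (f i - f j) * hQ.seminorm (g i) ≤ hQ.seminorm (f i - f j) * D :=
    mul_le_mul_of_nonneg_left (hD i) (apply_nonneg _ _)
  have h8 : hQ.seminorm (f j) * hQ.seminorm (g i - g j) ≤ C * hQ.seminorm (g i - g j) :=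
    mul_le_mul_of_nonneg_right (hC j) (apply_nonneg _ _)
  have h9 : 0 ≤ hQ.seminorm (f i - f j) := apply_nonneg _ _
  have h10 : 0 ≤ hQ.seminorm (g i - g j) := apply_nonneg _ _
  nlinarith

end QApprox

/-- The domain of the closure. -/
def closureDomain (hQ : IsPosForm Q) (T : V →ₗ[ℝ] H) : Submodule ℝ H where
  carrier := {h | ∃ u, QApprox Q T u h}
  zero_mem' := ⟨fun _ => 0, by simpa using QApprox.const Q T 0⟩
  add_mem' := by
    rintro h k ⟨u, hu⟩ ⟨v, hv⟩
    exact ⟨u + v, hu.add hQ hv⟩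
  smul_mem' := by
    rintro c h ⟨u, hu⟩
    exact ⟨c • u, hu.smul c⟩

theorem exists_closureForm (hQ : IsPosForm Q) (hcl : QClosable Q T) :
    ∃ F : closureDomain hQ T →ₗ[ℝ] closureDomain hQ T →ₗ[ℝ] ℝ,
      ∀ (v w : closureDomain hQ T) (f g : ℕ → V), QApprox Q T f v → QApprox Q T g w →
        Tendsto (fun n => Q (f n) (g n)) atTop (𝓝 (F v w)) := by
  choose a ha using fun v : closureDomain hQ T => v.2
  choose F hF using fun v w : closureDomain hQ T =>
    QApprox.exists_tendsto hQ (ha v).1 (ha w).1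
  have key : ∀ (v w : closureDomain hQ T) (f g : ℕ → V), QApprox Q T f v → QApprox Q T g w →
      Tendsto (fun n => Q (f n) (g n)) atTop (𝓝 (F v w)) := by
    intro v w f g hf hg
    have := (QApprox.tendsto_sub hQ hcl hf (ha v) hg (ha w)).add (hF v w)
    simpa using this
  refine ⟨LinearMap.mk₂ ℝ F ?_ ?_ ?_ ?_, key⟩
  · intro v v' w
    refine tendsto_nhds_unique (key (v + v') w _ _ ((ha v).add hQ (ha v')) (ha w)) ?_
    simpa using (hF v w).add (hF v' w)
  · intro c v w
    refine tendsto_nhds_unique (key (c • v) w _ _ ((ha v).smul c) (ha w)) ?_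
    simpa using (hF v w).const_mul c
  · intro v w w'
    refine tendsto_nhds_unique (key v (w + w') _ _ (ha v) ((ha w).add hQ (ha w'))) ?_
    simpa using (hF v w).add (hF v w')
  · intro c v w
    refine tendsto_nhds_unique (key v (c • w) _ _ (ha v) ((ha w).smul c)) ?_
    simpa using (hF v w).const_mul c

section ClosureForm

variable {hQ : IsPosForm Q} {F : closureDomain hQ T →ₗ[ℝ] closureDomain hQ T →ₗ[ℝ] ℝ}
  (hF : ∀ (v w : closureDomain hQ T) (f g : ℕ → V), QApprox Q T f v → QApprox Q T g w →
        Tendsto (fun n => Q (f n) (g n)) atTop (𝓝 (F v w)))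
include hF

theorem closureForm_isPosForm : IsPosForm F where
  symm v w := by
    obtain ⟨f, hf⟩ := v.2
    obtain ⟨g, hg⟩ := w.2
    refine tendsto_nhds_unique (hF v w f g hf hg) ?_
    simpa only [hQ.symm] using hF w v g f hg hf
  nonneg v := by
    obtain ⟨f, hf⟩ := v.2
    exact ge_of_tendsto' (hF v v f f hf hf) fun n => hQ.nonneg _

/-- The energy of `T (f n) - v` is the limit over `k` of that of `f n - f k`, which the Cauchy
property makes small. So the image of `V` is dense in the closure for the form as well. -/
theorem closureForm_tendsto {f : ℕ → V} {v : closureDomain hQ T} (hf : QApprox Q T f v)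
    (hfd : ∀ n, T (f n) ∈ closureDomain hQ T) :
    Tendsto (fun n => F (⟨T (f n), hfd n⟩ - v) (⟨T (f n), hfd n⟩ - v)) atTop (𝓝 0) := by
  have hpos := closureForm_isPosForm hF
  rw [Metric.tendsto_atTop]
  intro ε hε
  obtain ⟨N, hN⟩ := hf.1 (ε / 2) (by positivity)
  refine ⟨N, fun n hn => ?_⟩
  rw [Real.dist_eq, sub_zero, abs_of_nonneg (hpos.nonneg _)]
  have h1 : QApprox Q T ((fun _ => f n) - f) (⟨T (f n), hfd n⟩ - v : closureDomain hQ T) :=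
    (QApprox.const Q T (f n)).sub hQ hf
  refine (le_of_tendsto (hF _ _ _ _ h1 h1) ?_).trans_lt (half_lt_self hε)
  filter_upwards [eventually_ge_atTop N] with k hk
  exact (hN n hn k hk).le

/-- The closure of a closable form is closed. -/
theorem closureForm_closed (u : ℕ → closureDomain hQ T) (v : H)
    (hu : ∀ ε > 0, ∃ N, ∀ i ≥ N, ∀ j ≥ N, F (u i - u j) (u i - u j) < ε)
    (huv : Tendsto (fun n => (u n : H)) atTop (𝓝 v)) :
    ∃ hv : v ∈ closureDomain hQ T,
      Tendsto (fun n => F (u n - ⟨v, hv⟩) (u n - ⟨v, hv⟩)) atTop (𝓝 0) := by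
  have hpos := closureForm_isPosForm hF
  have hmem : ∀ f : V, T f ∈ closureDomain hQ T := fun f => ⟨_, QApprox.const Q T f⟩
  -- Each `u n` is replaced by an element of `V` that is `1 / (n + 1)`-close to it both in energy
  -- and in norm; the new sequence then approximates `v`.
  have hex : ∀ n : ℕ, ∃ f : V, F (⟨T f, hmem f⟩ - u n) (⟨T f, hmem f⟩ - u n) < 1 / (n + 1 : ℝ) ∧
      dist (T f) (u n) < 1 / (n + 1 : ℝ) := by
    intro n
    obtain ⟨f, hf⟩ := (u n).2
    have hn : (0 : ℝ) < 1 / (n + 1 : ℝ) := by positivity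
    obtain ⟨k, h1, h2⟩ := (((closureForm_tendsto hF hf fun k => hmem _).eventually_lt_const hn).and
      ((tendsto_iff_dist_tendsto_zero.1 hf.2).eventually_lt_const hn)).exists
    exact ⟨f k, h1, h2⟩
  choose f hf1 hf2 using hex
  have hlim := tendsto_one_div_add_atTop_nhds_zero_nat (𝕜 := ℝ)
  have hFQ : ∀ g : V, F ⟨T g, hmem g⟩ ⟨T g, hmem g⟩ = Q g g := fun g =>
    tendsto_nhds_unique (hF ⟨T g, hmem g⟩ ⟨T g, hmem g⟩ _ _ (QApprox.const Q T g)
      (QApprox.const Q T g)) tendsto_const_nhds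
  have hf : QApprox Q T f v := by
    constructor
    · have hd : QCauchy F fun n => (⟨T (f n), hmem _⟩ - u n : closureDomain hQ T) := by
        refine QCauchy.of_le (fun n => 4 * (1 / (n + 1 : ℝ))) (by simpa using hlim.const_mul 4) ?_
        intro i j hij
        have h1 := hpos.sub_le (⟨T (f i), hmem _⟩ - u i) (⟨T (f j), hmem _⟩ - u j)
        have h5 : 1 / (j + 1 : ℝ) ≤ 1 / (i + 1 : ℝ) := by gcongr
        linarith [hf1 i, hf1 j]
      have hs := hd.add hpos (v := u) hu
      intro ε hε
      obtain ⟨N, hN⟩ := hs ε hε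
      refine ⟨N, fun i hi j hj => ?_⟩
      have := hN i hi j hj
      simp only [Pi.add_apply, sub_add_cancel] at this
      rw [← hFQ]
      have h : (⟨T (f i - f j), hmem _⟩ : closureDomain hQ T) = ⟨T (f i), hmem _⟩ - ⟨T (f j), hmem _⟩ :=
        Subtype.ext (map_sub T _ _)
      rwa [h]
    · rw [tendsto_iff_dist_tendsto_zero] at huv ⊢
      refine squeeze_zero (fun _ => dist_nonneg) (fun n => ?_)
        (by simpa only [add_zero] using hlim.add huv)
      exact (dist_triangle _ (u n : H) _).trans (add_le_add (hf2 n).le le_rfl)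
  refine ⟨⟨f, hf⟩, ?_⟩
  have h1 := closureForm_tendsto hF (v := ⟨v, ⟨f, hf⟩⟩) hf fun n => hmem _
  refine squeeze_zero (fun _ => hpos.nonneg _) (fun n => ?_)
    (by simpa only [mul_zero, add_zero] using (hlim.const_mul 2).add (h1.const_mul 2))
  have h2 := hpos.sub_le (⟨T (f n), hmem _⟩ - ⟨v, ⟨f, hf⟩⟩) (⟨T (f n), hmem _⟩ - u n)
  rw [sub_sub_sub_cancel_left] at h2
  linarith [hf1 n]

end ClosureForm

end Closure

/-! ### Truncations, squares and the algebra `ℬ` -/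

/-- A Riemann sum for `t ^ 2 = ∫ 2 (t - s)⁺ ds`. -/
theorem abs_sum_sub_min_sub_sq_le {t h : ℝ} (N : ℕ) (ht : 0 ≤ t) (hh : 0 ≤ h) (htN : t ≤ N * h) :
    |∑ k ∈ Finset.range N, 2 * h * (t - min t (k * h)) - t * t| ≤ 2 * h * t := by
  set a : ℕ → ℝ := fun k => t - min t (k * h) with ha
  have h0 : a 0 = t := by simp [ha, ht]
  have hN : a N = 0 := by simp [ha, htN]
  have hsq : t * t = ∑ k ∈ Finset.range N, (a k ^ 2 - a (k + 1) ^ 2) := by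
    rw [Finset.sum_range_sub' (fun k => a k ^ 2), h0, hN]; ring
  have hlin : 2 * h * t = ∑ k ∈ Finset.range N, 2 * h * (a k - a (k + 1)) := by
    rw [← Finset.mul_sum, Finset.sum_range_sub', h0, hN, sub_zero]
  -- The values `a k = (t - k h)⁺` decrease by exactly `h` until they reach zero. In either case the
  -- error of one summand is at most `2 h (a k - a (k + 1))`, which telescopes to `2 h t`.
  have hstep : ∀ k : ℕ, 0 ≤ a k ∧ 0 ≤ a (k + 1) ∧ a (k + 1) ≤ a k ∧ a k ≤ a (k + 1) + h ∧
      (a (k + 1) = 0 ∨ a k = a (k + 1) + h) := by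
    intro k
    simp only [ha, Nat.cast_add, Nat.cast_one, add_mul, one_mul]
    rcases le_total t (k * h) with h1 | h1
    · rw [min_eq_left h1, min_eq_left (by linarith)]
      simp [hh]
    · rw [min_eq_right h1]
      rcases le_total t (k * h + h) with h2 | h2
      · rw [min_eq_left h2]
        refine ⟨by linarith, by simp, by linarith, by linarith, Or.inl (by simp)⟩
      · rw [min_eq_right h2]
        refine ⟨by linarith, by linarith, by linarith, by linarith, Or.inr (by ring)⟩
  rw [hsq, hlin, ← Finset.sum_sub_distrib]
  refine (Finset.abs_sum_le_sum_abs _ _).trans (Finset.sum_le_sum fun k _ => ?_)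
  obtain ⟨h1, h2, h3, h4, h5⟩ := hstep k
  change |2 * h * a k - _| ≤ _
  rw [abs_le]
  rcases h5 with h5 | h5
  · rw [h5] at h4 ⊢
    constructor <;> nlinarith
  · rw [h5]
    constructor <;> nlinarith

namespace DirichletForm

variable {X : Type*} {mX : MeasurableSpace X} {μ : Measure X} (D : DirichletForm μ)

theorem isPosForm : IsPosForm D.form := ⟨D.symm, D.nonneg⟩

/-- Bounded energy suffices for the limit to stay in the domain: convex combinations are Cauchy for
the form and keep the same `L²`-limit, so closedness applies to them. -/
theorem mem_domain_of_tendsto (u : ℕ → D.domain) {C : ℝ} (hu : ∀ n, D.form (u n) (u n) ≤ C)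
    {v : Lp ℝ 2 μ} (huv : Tendsto (fun n => (u n : Lp ℝ 2 μ)) atTop (𝓝 v)) : v ∈ D.domain := by
  obtain ⟨y, hy, hyv, -⟩ := exists_qCauchy_tendsto D.isPosForm D.domain.subtype u hu
    (tendsto_const_nhds (x := C)) huv
  exact (D.closed y v hy hyv).1

variable {D}

theorem InDomain.of_ae_eq {f : X → ℝ} (v : D.domain) (h : ((v : Lp ℝ 2 μ) : X → ℝ) =ᵐ[μ] f) :
    D.InDomain f := by
  have hf : MemLp f 2 μ := (memLp_congr_ae h).1 (Lp.memLp _)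
  refine ⟨hf, ?_⟩
  have : hf.toLp f = v := by
    rw [← Lp.toLp_coeFn (v : Lp ℝ 2 μ) (Lp.memLp _)]
    exact MemLp.toLp_eq_toLp_iff _ _ |>.2 h.symm
  rw [this]
  exact v.2

theorem InDomain.add {f g : X → ℝ} (hf : D.InDomain f) (hg : D.InDomain g) :
    D.InDomain (f + g) := by
  obtain ⟨hf, hf'⟩ := hf
  obtain ⟨hg, hg'⟩ := hg
  exact ⟨hf.add hg, by rw [MemLp.toLp_add hf hg]; exact D.domain.add_mem hf' hg'⟩

theorem InDomain.const_smul {f : X → ℝ} (hf : D.InDomain f) (c : ℝ) : D.InDomain (c • f) := by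
  obtain ⟨hf, hf'⟩ := hf
  exact ⟨hf.const_smul c, by rw [MemLp.toLp_const_smul c hf]; exact D.domain.smul_mem c hf'⟩

variable (D)

/-- The algebra `ℬ` as a linear subspace. -/
def boundedSubmodule : Submodule ℝ (X → ℝ) where
  carrier := D.boundedAlgebra
  zero_mem' := ⟨measurable_zero, ⟨0, by simp⟩, integrable_zero _ _ _,
    InDomain.of_ae_eq 0 (by simpa using Lp.coeFn_zero ℝ 2 μ)⟩
  add_mem' := by
    rintro f g ⟨hf1, ⟨C, hC⟩, hf3, hf4⟩ ⟨hg1, ⟨C', hC'⟩, hg3, hg4⟩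
    exact ⟨hf1.add hg1, ⟨C + C', fun x => (abs_add_le _ _).trans (add_le_add (hC x) (hC' x))⟩,
      hf3.add hg3, hf4.add hg4⟩
  smul_mem' := by
    rintro c f ⟨hf1, ⟨C, hC⟩, hf3, hf4⟩
    refine ⟨hf1.const_smul c, ⟨|c| * C, fun x => ?_⟩, hf3.smul c, hf4.const_smul c⟩
    rw [Pi.smul_apply, smul_eq_mul, abs_mul]
    exact mul_le_mul_of_nonneg_left (hC x) (abs_nonneg c)

variable {D}

theorem memLp_of_mem {f : X → ℝ} (hf : f ∈ D.boundedAlgebra) : MemLp f 2 μ := hf.2.2.2.choose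

variable (D)

/-- The map that sends a function in `ℬ` to its `μ`-class. -/
noncomputable def toDomain : D.boundedSubmodule →ₗ[ℝ] D.domain where
  toFun f := ⟨(memLp_of_mem f.2).toLp f, f.2.2.2.2.choose_spec⟩
  map_add' _ _ := rfl
  map_smul' _ _ := rfl

theorem coe_toDomain (f : D.boundedSubmodule) :
    ((D.toDomain f : Lp ℝ 2 μ) : X → ℝ) =ᵐ[μ] f :=
  MemLp.coeFn_toLp (memLp_of_mem f.2)

/-- The form on `ℬ`. -/
noncomputable def energyForm : D.boundedSubmodule →ₗ[ℝ] D.boundedSubmodule →ₗ[ℝ] ℝ :=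
  D.form.compl₁₂ D.toDomain D.toDomain

theorem energyForm_apply (f g : D.boundedSubmodule) :
    D.energyForm f g = D.form (D.toDomain f) (D.toDomain g) := rfl

theorem energyForm_isPosForm : IsPosForm D.energyForm where
  symm _ _ := D.symm _ _
  nonneg _ := D.nonneg _

theorem energy_coe (f g : D.boundedSubmodule) : D.energy f g = D.energyForm f g :=
  dif_pos ⟨f.2.2.2.2, g.2.2.2.2⟩

theorem energy_eq {f g : X → ℝ} (hf : f ∈ D.boundedAlgebra) (hg : g ∈ D.boundedAlgebra) :
    D.energy f g = D.energyForm ⟨f, hf⟩ ⟨g, hg⟩ :=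
  dif_pos ⟨hf.2.2.2, hg.2.2.2⟩

theorem energyForm_eq_of_ae (f : D.boundedSubmodule) (v : D.domain)
    (h : ((v : Lp ℝ 2 μ) : X → ℝ) =ᵐ[μ] f) : D.energyForm f f = D.form v v := by
  have : D.toDomain f = v := Subtype.ext (Lp.ext ((D.coe_toDomain f).trans h.symm))
  rw [energyForm_apply, this]

/-- The contraction `f ↦ (f ∨ 0) ∧ c` operates on `ℬ`. -/
theorem exists_contraction (f : D.boundedSubmodule) {c : ℝ} (hc : 0 ≤ c) :
    ∃ g : D.boundedSubmodule, (∀ x, (g : X → ℝ) x = min (max ((f : X → ℝ) x) 0) c) ∧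
      D.energyForm g g ≤ D.energyForm f f := by
  rcases hc.eq_or_lt with rfl | hc
  · exact ⟨0, fun x => by simp, by simpa using D.energyForm_isPosForm.nonneg f⟩
  obtain ⟨v, hv, hle⟩ := D.markov (D.toDomain (c⁻¹ • f))
  set g : X → ℝ := fun x => min (max ((f : X → ℝ) x) 0) c with hg
  have hcv : (((c • v : D.domain) : Lp ℝ 2 μ) : X → ℝ) =ᵐ[μ] g := by
    rw [Submodule.coe_smul]
    filter_upwards [Lp.coeFn_smul c (v : Lp ℝ 2 μ), hv, D.coe_toDomain (c⁻¹ • f)] with x h1 h2 h3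
    rw [h1, Pi.smul_apply, h2, h3]
    simp only [Submodule.coe_smul, Pi.smul_apply, smul_eq_mul, hg]
    rw [mul_min_of_nonneg _ _ hc.le, mul_max_of_nonneg _ _ hc.le, mul_inv_cancel_left₀ hc.ne',
      mul_zero, mul_one]
  have habs : ∀ x, |g x| ≤ |(f : X → ℝ) x| := by
    intro x
    rw [hg, abs_of_nonneg (le_min (le_max_right _ _) hc.le)]
    exact (min_le_left _ _).trans (max_le (le_abs_self _) (abs_nonneg _))
  have hgm : Measurable g := (f.2.1.max measurable_const).min measurable_const
  have hgB : g ∈ D.boundedAlgebra := by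
    refine ⟨hgm, ?_, ?_, InDomain.of_ae_eq _ hcv⟩
    · obtain ⟨C, hC⟩ := f.2.2.1
      exact ⟨C, fun x => (habs x).trans (hC x)⟩
    · exact f.2.2.2.1.mono hgm.aestronglyMeasurable (ae_of_all _ habs)
  refine ⟨⟨g, hgB⟩, fun _ => rfl, ?_⟩
  rw [D.energyForm_eq_of_ae ⟨g, hgB⟩ _ hcv]
  rw [← energyForm_apply] at hle
  simp only [map_smul, LinearMap.smul_apply, smul_eq_mul] at hle ⊢
  calc c * (c * D.form v v) ≤ c * (c * (c⁻¹ * (c⁻¹ * D.energyForm f f))) := by gcongr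
    _ = D.energyForm f f := by field_simp

/-- Only contractions of the type `(t ∨ 0) ∧ c` are available, so the square is written as a limit
of Riemann sums for `f² = ∫ 2 (f - f ∧ s) ds`. These sums have bounded energy and converge in
`L²(μ)`. -/
theorem mul_self_mem_of_nonneg (f : D.boundedSubmodule) (hf : ∀ x, 0 ≤ (f : X → ℝ) x) :
    (f : X → ℝ) * (f : X → ℝ) ∈ D.boundedAlgebra := by
  obtain ⟨hfm, ⟨M, hM⟩, hfi, hfd⟩ := f.2
  have hM' : ∀ x, (f : X → ℝ) x ≤ |M| := fun x =>
    (le_abs_self _).trans ((hM x).trans (le_abs_self M))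
  have hffi : Integrable ((f : X → ℝ) * (f : X → ℝ)) μ :=
    hfi.bdd_mul (c := M) hfm.aestronglyMeasurable (ae_of_all _ hM)
  have hff2 : MemLp ((f : X → ℝ) * (f : X → ℝ)) 2 μ :=
    (memLp_of_mem f.2).of_le_mul (c := M) (hfm.mul hfm).aestronglyMeasurable
      (ae_of_all _ fun x => by
        rw [Pi.mul_apply, norm_mul]
        exact mul_le_mul_of_nonneg_right (hM x) (norm_nonneg _))
  refine ⟨hfm.mul hfm, ⟨M * M, fun x => ?_⟩, hffi, hff2, ?_⟩
  · rw [Pi.mul_apply, abs_mul]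
    exact mul_le_mul (hM x) (hM x) (abs_nonneg _) ((abs_nonneg _).trans (hM x))
  -- With this mesh, `N + 1` levels reach `|M| ≥ f`.
  set h : ℕ → ℝ := fun N => |M| * (1 / (N + 1 : ℝ)) with hh
  have hh0 : ∀ N, 0 ≤ h N := fun N => by positivity
  choose g hg1 hg2 using fun N k : ℕ => D.exists_contraction f (c := k * h N)
    (mul_nonneg k.cast_nonneg (hh0 N))
  have hg : ∀ N k x, (g N k : X → ℝ) x = min ((f : X → ℝ) x) (k * h N) := fun N k x => by
    rw [hg1, max_eq_left (hf x)]
  set s : ℕ → D.boundedSubmodule :=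
    fun N => ∑ k ∈ Finset.range (N + 1), (2 * h N) • (f - g N k) with hs
  have hsx : ∀ N x, |(s N : X → ℝ) x - (f : X → ℝ) x * (f : X → ℝ) x| ≤
      2 * h N * (f : X → ℝ) x := by
    intro N x
    have := abs_sum_sub_min_sub_sq_le (t := (f : X → ℝ) x) (h := h N) (N + 1) (hf x) (hh0 N) (by
      simp only [hh]; push_cast; field_simp; exact hM' x)
    convert this using 3
    simp only [hs, Submodule.coe_sum, Finset.sum_apply, Submodule.coe_smul, Submodule.coe_sub,
      Pi.smul_apply, Pi.sub_apply, smul_eq_mul, hg]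
  have hE := D.energyForm_isPosForm
  -- Each summand `2 h (f - f ∧ k h)` has energy at most `4 h² · 4 E(f)`. A sum of `N + 1` of them
  -- costs a factor `(N + 1)²`, and `(N + 1) h = |M|` gives the constant `16 M²`.
  refine D.mem_domain_of_tendsto (fun N => D.toDomain (s N))
    (C := 16 * M ^ 2 * D.energyForm f f) (fun N => ?_) ?_
  · rw [← energyForm_apply]
    have h0 := hE.nonneg f
    refine (hE.sum_le (C := 16 * h N ^ 2 * D.energyForm f f) (by positivity) (N + 1) _
      fun k _ => ?_).trans (le_of_eq ?_)
    · have h1 := hE.sub_le f (g N k)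
      have h2 := hg2 N k
      rw [IsPosForm.smul_smul]
      nlinarith [mul_nonneg (hh0 N) (hh0 N)]
    · rw [← sq_abs M]
      simp only [hh]; push_cast; field_simp
  · rw [tendsto_iff_dist_tendsto_zero]
    have hlim : Tendsto (fun N => 2 * h N * ‖(D.toDomain f : Lp ℝ 2 μ)‖) atTop (𝓝 0) := by
      have := (((tendsto_one_div_add_atTop_nhds_zero_nat (𝕜 := ℝ)).const_mul |M|).const_mul
        2).mul_const ‖(D.toDomain f : Lp ℝ 2 μ)‖
      simpa only [mul_zero, zero_mul] using this
    refine squeeze_zero (fun _ => dist_nonneg) (fun N => ?_) hlim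
    rw [dist_eq_norm]
    apply Lp.norm_le_mul_norm_of_ae_le_mul
    filter_upwards [Lp.coeFn_sub (D.toDomain (s N) : Lp ℝ 2 μ) (hff2.toLp _), D.coe_toDomain f,
      D.coe_toDomain (s N), hff2.coeFn_toLp] with x h1 h2 h3 h4
    rw [h1, Pi.sub_apply, h2, h3, h4, Real.norm_eq_abs, Real.norm_eq_abs, abs_of_nonneg (hf x)]
    exact hsx N x

/-- Positive and negative part of a function in `ℬ`. -/
theorem exists_posPart (f : D.boundedSubmodule) :
    ∃ g : D.boundedSubmodule, ∀ x, (g : X → ℝ) x = max ((f : X → ℝ) x) 0 := by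
  obtain ⟨M, hM⟩ := f.2.2.1
  obtain ⟨g, hg, -⟩ := D.exists_contraction f (abs_nonneg M)
  refine ⟨g, fun x => ?_⟩
  rw [hg, min_eq_left]
  exact max_le ((le_abs_self _).trans ((hM x).trans (le_abs_self M))) (abs_nonneg M)

theorem mul_self_mem (f : D.boundedSubmodule) : (f : X → ℝ) * (f : X → ℝ) ∈ D.boundedAlgebra := by
  obtain ⟨g, hg⟩ := D.exists_posPart f
  obtain ⟨g', hg'⟩ := D.exists_posPart (-f)
  have h : (f : X → ℝ) * (f : X → ℝ) = (g : X → ℝ) * (g : X → ℝ) + (g' : X → ℝ) * (g' : X → ℝ) := by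
    ext x
    simp only [Pi.mul_apply, Pi.add_apply, hg, hg', Submodule.coe_neg, Pi.neg_apply]
    rcases le_total ((f : X → ℝ) x) 0 with h | h
    · rw [max_eq_right h, max_eq_left (by linarith)]; ring
    · rw [max_eq_left h, max_eq_right (by linarith)]; ring
  rw [h]
  exact D.boundedSubmodule.add_mem
    (D.mul_self_mem_of_nonneg g fun x => by rw [hg]; exact le_max_right _ _)
    (D.mul_self_mem_of_nonneg g' fun x => by rw [hg']; exact le_max_right _ _)

variable {D}

/-- `ℬ` is an algebra. -/
theorem mul_mem {f g : X → ℝ} (hf : f ∈ D.boundedAlgebra) (hg : g ∈ D.boundedAlgebra) :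
    f * g ∈ D.boundedAlgebra := by
  have h : f * g = (1 / 4 : ℝ) • ((f + g) * (f + g) - (f - g) * (f - g)) := by
    ext x
    simp only [Pi.mul_apply, Pi.add_apply, Pi.sub_apply, Pi.smul_apply, smul_eq_mul]
    ring
  rw [h]
  have hf' : f ∈ D.boundedSubmodule := hf
  have hg' : g ∈ D.boundedSubmodule := hg
  exact D.boundedSubmodule.smul_mem _ (D.boundedSubmodule.sub_mem
    (D.mul_self_mem ⟨f + g, add_mem hf' hg'⟩) (D.mul_self_mem ⟨f - g, sub_mem hf' hg'⟩))

theorem measurable_sigmaB {f : X → ℝ} (hf : f ∈ D.boundedAlgebra) : Measurable[D.sigmaB] f := by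
  rw [measurable_iff_comap_le]
  exact le_iSup₂_of_le f hf le_rfl

end DirichletForm

/-! ### Densities of the local energy measures -/

/-- Splitting `ρ` into positive and negative parts reduces this to ordinary measures with densities.
It turns the product rule for signed measures into an almost everywhere identity between densities.
-/
theorem withDensity_withDensityᵥ {X : Type*} {mX : MeasurableSpace X} {m : Measure X}
    {f ρ : X → ℝ} (hf : Measurable f) {C : ℝ} (hC : ∀ x, |f x| ≤ C) (hρm : Measurable ρ)
    (hρ : Integrable ρ m) :
    (m.withDensityᵥ ρ).withDensity f (ContinuousLinearMap.lsmul ℝ ℝ) =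
      m.withDensityᵥ (fun x => f x * ρ x) := by
  have hP := isFiniteMeasure_withDensity_ofReal hρ.2
  have hN := isFiniteMeasure_withDensity_ofReal hρ.neg.2
  have hflip : (ContinuousLinearMap.lsmul ℝ ℝ : ℝ →L[ℝ] ℝ →L[ℝ] ℝ) =
      (ContinuousLinearMap.lsmul ℝ ℝ : ℝ →L[ℝ] ℝ →L[ℝ] ℝ).flip := by
    ext; simp
  have hint : ∀ ν : Measure X, ∀ [IsFiniteMeasure ν], Integrable f ν := fun ν _ =>
    Integrable.of_bound hf.aestronglyMeasurable C (ae_of_all _ hC)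
  have hintv : ∀ ν : Measure X, ∀ [IsFiniteMeasure ν], ν.toSignedMeasure.Integrable f := by
    intro ν _
    rw [VectorMeasure.Integrable, Measure.variation_toSignedMeasure]
    exact hint ν
  have hfρ : Integrable (fun x => f x * ρ x) m :=
    hρ.bdd_mul hf.aestronglyMeasurable (ae_of_all _ hC)
  have hmulint : ∀ τ : X → ℝ, Measurable τ → Integrable τ m →
      Integrable (fun x => max (τ x) 0 * f x) m := fun τ hτm hτ =>
    hτ.pos_part.mul_bdd hf.aestronglyMeasurable (ae_of_all _ hC)
  ext s hs
  rw [withDensityᵥ_eq_withDensity_pos_part_sub_withDensity_neg_part hρ,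
    VectorMeasure.withDensity_apply ((hintv _).sub_vectorMeasure (hintv _)),
    withDensityᵥ_apply hfρ hs, VectorMeasure.restrict_sub,
    VectorMeasure.integral_sub_vectorMeasure (hintv _).restrict (hintv _).restrict, hflip,
    VectorMeasure.setIntegral_toSignedMeasure hs, VectorMeasure.setIntegral_toSignedMeasure hs,
    setIntegral_withDensity_eq_setIntegral_toReal_smul hρm.ennreal_ofReal
      (ae_of_all _ fun _ => ENNReal.ofReal_lt_top) _ hs,
    setIntegral_withDensity_eq_setIntegral_toReal_smul (f := fun x => ENNReal.ofReal (-ρ x))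
      hρm.neg.ennreal_ofReal
      (ae_of_all _ fun _ => ENNReal.ofReal_lt_top) _ hs]
  simp only [ENNReal.toReal_ofReal', smul_eq_mul]
  rw [← integral_sub (hmulint ρ hρm hρ).integrableOn
    (hmulint (fun x => -ρ x) hρm.neg hρ.neg).integrableOn]
  refine integral_congr_ae (ae_of_all _ fun x => ?_)
  simp only
  rcases le_total (ρ x) 0 with h | h
  · rw [max_eq_right h, max_eq_left (by linarith)]; ring
  · rw [max_eq_left h, max_eq_right (by linarith)]; ring

/-- A signed measure valued symmetric bilinear derivation on an algebra `A` of bounded measurable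
functions. -/
structure IsLocalForm {X : Type*} {mX : MeasurableSpace X} (A : Submodule ℝ (X → ℝ))
    (Γ : (X → ℝ) → (X → ℝ) → SignedMeasure X) : Prop where
  measurable : ∀ f ∈ A, Measurable f
  bdd : ∀ f ∈ A, ∃ C, ∀ x, |f x| ≤ C
  mul_mem : ∀ f ∈ A, ∀ g ∈ A, f * g ∈ A
  symm : ∀ f ∈ A, ∀ g ∈ A, Γ f g = Γ g f
  add : ∀ f ∈ A, ∀ g ∈ A, ∀ h ∈ A, Γ (f + g) h = Γ f h + Γ g h
  smul : ∀ (c : ℝ), ∀ f ∈ A, ∀ h ∈ A, Γ (c • f) h = c • Γ f h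
  nonneg : ∀ f ∈ A, ∀ s, 0 ≤ Γ f f s
  mul : ∀ f ∈ A, ∀ g ∈ A, ∀ h ∈ A, Γ (f * g) h =
      (Γ g h).withDensity f (ContinuousLinearMap.lsmul ℝ ℝ) +
      (Γ f h).withDensity g (ContinuousLinearMap.lsmul ℝ ℝ)

namespace IsLocalForm

variable {X : Type*} {mX : MeasurableSpace X} {A : Submodule ℝ (X → ℝ)}
  {Γ : (X → ℝ) → (X → ℝ) → SignedMeasure X} {m : Measure X} [IsFiniteMeasure m]

omit [IsFiniteMeasure m] in
-- Polarization: `2 Γ f g = Γ (f + g) (f + g) - Γ f f - Γ g g`.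
theorem absolutelyContinuous (hΓ : IsLocalForm A Γ)
    (hm : ∀ f ∈ A, Γ f f ≪ᵥ m.toENNRealVectorMeasure) {f g : X → ℝ} (hf : f ∈ A) (hg : g ∈ A) :
    Γ f g ≪ᵥ m.toENNRealVectorMeasure := by
  intro s hs
  have h1 := hm _ (A.add_mem hf hg) hs
  rw [hΓ.add f hf g hg _ (A.add_mem hf hg), hΓ.symm f hf _ (A.add_mem hf hg),
    hΓ.symm g hg _ (A.add_mem hf hg), hΓ.add f hf g hg f hf, hΓ.add f hf g hg g hg,
    hΓ.symm g hg f hf] at h1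
  simp only [_root_.add_apply, hm f hf hs, hm g hg hs] at h1
  linarith

variable (hΓ : IsLocalForm A Γ) (hm : ∀ f ∈ A, Γ f f ≪ᵥ m.toENNRealVectorMeasure)
include hΓ hm

theorem withDensityᵥ_eq {f g : X → ℝ} (hf : f ∈ A) (hg : g ∈ A) :
    m.withDensityᵥ ((Γ f g).rnDeriv m) = Γ f g :=
  ((Γ f g).absolutelyContinuous_iff_withDensityᵥ_rnDeriv_eq m).1
    (hΓ.absolutelyContinuous hm hf hg)

theorem apply_univ {f g : X → ℝ} (hf : f ∈ A) (hg : g ∈ A) :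
    Γ f g Set.univ = ∫ x, (Γ f g).rnDeriv m x ∂m := by
  conv_lhs => rw [← hΓ.withDensityᵥ_eq hm hf hg]
  rw [withDensityᵥ_apply (SignedMeasure.integrable_rnDeriv _ _) MeasurableSet.univ,
    Measure.restrict_univ]

theorem rnDeriv_add {f g h : X → ℝ} (hf : f ∈ A) (hg : g ∈ A) (hh : h ∈ A) :
    (Γ (f + g) h).rnDeriv m =ᵐ[m] (Γ f h).rnDeriv m + (Γ g h).rnDeriv m := by
  rw [← (SignedMeasure.integrable_rnDeriv _ _).withDensityᵥ_eq_iff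
    ((SignedMeasure.integrable_rnDeriv _ _).add (SignedMeasure.integrable_rnDeriv _ _)),
    withDensityᵥ_add (SignedMeasure.integrable_rnDeriv _ _) (SignedMeasure.integrable_rnDeriv _ _),
    hΓ.withDensityᵥ_eq hm (A.add_mem hf hg) hh, hΓ.withDensityᵥ_eq hm hf hh,
    hΓ.withDensityᵥ_eq hm hg hh, hΓ.add f hf g hg h hh]

theorem rnDeriv_smul (c : ℝ) {f h : X → ℝ} (hf : f ∈ A) (hh : h ∈ A) :
    (Γ (c • f) h).rnDeriv m =ᵐ[m] c • (Γ f h).rnDeriv m := by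
  rw [← (SignedMeasure.integrable_rnDeriv _ _).withDensityᵥ_eq_iff
    ((SignedMeasure.integrable_rnDeriv _ _).smul c), withDensityᵥ_smul,
    hΓ.withDensityᵥ_eq hm (A.smul_mem c hf) hh, hΓ.withDensityᵥ_eq hm hf hh, hΓ.smul c f hf h hh]

theorem rnDeriv_nonneg {f : X → ℝ} (hf : f ∈ A) : 0 ≤ᵐ[m] (Γ f f).rnDeriv m := by
  refine ae_nonneg_of_forall_setIntegral_nonneg (SignedMeasure.integrable_rnDeriv _ _)
    fun s hs _ => ?_
  rw [← withDensityᵥ_apply (SignedMeasure.integrable_rnDeriv _ _) hs,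
    hΓ.withDensityᵥ_eq hm hf hf]
  exact hΓ.nonneg f hf s

theorem rnDeriv_mul {f g h : X → ℝ} (hf : f ∈ A) (hg : g ∈ A) (hh : h ∈ A) :
    (Γ (f * g) h).rnDeriv m =ᵐ[m]
      fun x => f x * (Γ g h).rnDeriv m x + g x * (Γ f h).rnDeriv m x := by
  obtain ⟨C, hC⟩ := hΓ.bdd f hf
  obtain ⟨C', hC'⟩ := hΓ.bdd g hg
  have h1 : Integrable (fun x => f x * (Γ g h).rnDeriv m x) m :=
    (SignedMeasure.integrable_rnDeriv _ _).bdd_mul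
      (hΓ.measurable f hf).aestronglyMeasurable (ae_of_all _ hC)
  have h2 : Integrable (fun x => g x * (Γ f h).rnDeriv m x) m :=
    (SignedMeasure.integrable_rnDeriv _ _).bdd_mul
      (hΓ.measurable g hg).aestronglyMeasurable (ae_of_all _ hC')
  have h3 : m.withDensityᵥ ((Γ (f * g) h).rnDeriv m) = m.withDensityᵥ
      ((fun x => f x * (Γ g h).rnDeriv m x) + fun x => g x * (Γ f h).rnDeriv m x) := by
    rw [withDensityᵥ_add h1 h2, ← withDensity_withDensityᵥ (hΓ.measurable f hf) hC
        (SignedMeasure.measurable_rnDeriv _ _) (SignedMeasure.integrable_rnDeriv _ _),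
      ← withDensity_withDensityᵥ (hΓ.measurable g hg) hC'
        (SignedMeasure.measurable_rnDeriv _ _) (SignedMeasure.integrable_rnDeriv _ _),
      hΓ.withDensityᵥ_eq hm (hΓ.mul_mem f hf g hg) hh, hΓ.withDensityᵥ_eq hm hg hh,
      hΓ.withDensityᵥ_eq hm hf hh, hΓ.mul f hf g hg h hh]
  exact ((SignedMeasure.integrable_rnDeriv _ _).withDensityᵥ_eq_iff (h1.add h2)).1 h3

open Polynomial in
/-- The chain rule for polynomials without constant term. -/
theorem rnDeriv_polynomial {u g : X → ℝ} (hu : u ∈ A) (hg : g ∈ A) (q : ℝ[X]) :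
    (fun x => (Polynomial.X * q).eval (u x)) ∈ A ∧
      (Γ (fun x => (Polynomial.X * q).eval (u x)) g).rnDeriv m =ᵐ[m]
        fun x => (derivative (Polynomial.X * q)).eval (u x) * (Γ u g).rnDeriv m x := by
  induction q using Polynomial.induction_on with
  | C a =>
    have h : (fun x => (Polynomial.X * C a).eval (u x)) = a • u := by
      ext x
      simp only [eval_mul, eval_X, eval_C, Pi.smul_apply, smul_eq_mul]
      ring
    rw [h]
    refine ⟨A.smul_mem a hu, ?_⟩
    filter_upwards [hΓ.rnDeriv_smul hm a hu hg] with x hx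
    rw [hx]
    simp
  | add p q hp hq =>
    have h : (fun x => (Polynomial.X * (p + q)).eval (u x)) =
        (fun x => (Polynomial.X * p).eval (u x)) + fun x => (Polynomial.X * q).eval (u x) := by
      ext x; simp [mul_add]
    rw [h]
    refine ⟨A.add_mem hp.1 hq.1, ?_⟩
    filter_upwards [hΓ.rnDeriv_add hm hp.1 hq.1 hg, hp.2, hq.2] with x hx h1 h2
    rw [hx, Pi.add_apply, h1, h2, mul_add, derivative_add, eval_add, add_mul]
  | monomial n a hn =>
    have h : (fun x => (Polynomial.X * (C a * Polynomial.X ^ (n + 1))).eval (u x)) =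
        (fun x => (Polynomial.X * (C a * Polynomial.X ^ n)).eval (u x)) * u := by
      ext x; simp [pow_succ]; ring
    rw [h]
    refine ⟨hΓ.mul_mem _ hn.1 _ hu, ?_⟩
    filter_upwards [hΓ.rnDeriv_mul hm hn.1 hu hg, hn.2] with x hx h1
    rw [hx, h1]
    have h2 : Polynomial.X * (C a * Polynomial.X ^ (n + 1)) =
        (Polynomial.X * (C a * Polynomial.X ^ n)) * Polynomial.X := by ring
    rw [h2, derivative_mul (f := Polynomial.X * (C a * Polynomial.X ^ n))]
    simp only [eval_add, eval_mul, derivative_X, eval_one, eval_X]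
    ring

open Polynomial in
theorem rnDeriv_polynomial_self {u : X → ℝ} (hu : u ∈ A) (q : ℝ[X]) :
    (Γ (fun x => (Polynomial.X * q).eval (u x)) (fun x => (Polynomial.X * q).eval (u x))).rnDeriv m =ᵐ[m]
        fun x => (derivative (Polynomial.X * q)).eval (u x) ^ 2 * (Γ u u).rnDeriv m x := by
  obtain ⟨hp, -⟩ := hΓ.rnDeriv_polynomial hm hu hu q
  filter_upwards [(hΓ.rnDeriv_polynomial hm hu hp q).2, (hΓ.rnDeriv_polynomial hm hu hu q).2]
    with x h1 h2
  rw [h1, hΓ.symm u hu _ hp, h2]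
  ring

theorem rnDeriv_mul_self {f g : X → ℝ} (hf : f ∈ A) (hg : g ∈ A) :
    (Γ (f * g) (f * g)).rnDeriv m =ᵐ[m] fun x => f x ^ 2 * (Γ g g).rnDeriv m x +
      2 * (f x * g x) * (Γ f g).rnDeriv m x + g x ^ 2 * (Γ f f).rnDeriv m x := by
  have hfg := hΓ.mul_mem f hf g hg
  filter_upwards [hΓ.rnDeriv_mul hm hf hg hfg, hΓ.rnDeriv_mul hm hf hg hf,
    hΓ.rnDeriv_mul hm hf hg hg] with x h1 h2 h3
  rw [h1, hΓ.symm g hg _ hfg, hΓ.symm f hf _ hfg, h2, h3, hΓ.symm g hg f hf]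
  ring

/-- Nonnegativity of the density of `a f + b g` holds off a null set depending on `a` and `b`.
Rational coefficients give one common null set, and continuity extends the inequality to real ones,
which may then be chosen depending on the point. -/
theorem rnDeriv_sq_le {f g : X → ℝ} (hf : f ∈ A) (hg : g ∈ A) :
    ∀ᵐ x ∂m, ∀ a b : ℝ, 0 ≤ a ^ 2 * (Γ f f).rnDeriv m x + 2 * (a * b) * (Γ f g).rnDeriv m x +
      b ^ 2 * (Γ g g).rnDeriv m x := by
  have hab : ∀ᵐ x ∂m, ∀ a b : ℚ, 0 ≤ (a : ℝ) ^ 2 * (Γ f f).rnDeriv m x +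
      2 * (a * b) * (Γ f g).rnDeriv m x + (b : ℝ) ^ 2 * (Γ g g).rnDeriv m x := by
    rw [ae_all_iff]; intro a
    rw [ae_all_iff]; intro b
    have hfa := A.smul_mem (a : ℝ) hf
    have hgb := A.smul_mem (b : ℝ) hg
    have hs := A.add_mem hfa hgb
    filter_upwards [hΓ.rnDeriv_nonneg hm hs, hΓ.rnDeriv_add hm hfa hgb hs,
      hΓ.rnDeriv_smul hm a hf hs, hΓ.rnDeriv_smul hm b hg hs,
      hΓ.rnDeriv_add hm hfa hgb hf, hΓ.rnDeriv_add hm hfa hgb hg,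
      hΓ.rnDeriv_smul hm a hf hf, hΓ.rnDeriv_smul hm b hg hf,
      hΓ.rnDeriv_smul hm a hf hg, hΓ.rnDeriv_smul hm b hg hg]
      with x h0 h1 h2 h3 h4 h5 h6 h7 h8 h9
    rw [h1, Pi.add_apply, h2, h3, Pi.smul_apply, Pi.smul_apply, hΓ.symm f hf _ hs,
      hΓ.symm g hg _ hs, h4, h5, Pi.add_apply, Pi.add_apply, h6, h7, h8, h9,
      hΓ.symm g hg f hf] at h0
    simp only [Pi.zero_apply, Pi.smul_apply, smul_eq_mul] at h0
    linarith
  filter_upwards [hab] with x hx a b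
  have hcl : IsClosed {p : ℝ × ℝ | 0 ≤ p.1 ^ 2 * (Γ f f).rnDeriv m x +
      2 * (p.1 * p.2) * (Γ f g).rnDeriv m x + p.2 ^ 2 * (Γ g g).rnDeriv m x} :=
    isClosed_le continuous_const (by fun_prop)
  have hd : DenseRange (Prod.map ((↑) : ℚ → ℝ) ((↑) : ℚ → ℝ)) :=
    Rat.denseRange_cast.prodMap Rat.denseRange_cast
  have := hcl.closure_subset_iff.2 (by rintro _ ⟨⟨p, q⟩, rfl⟩; exact hx p q) (hd (a, b))
  exact this

/-- Comparison of the densities of `Γ (f g)` and `f ^ 2 Γ (g)`. -/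
theorem rnDeriv_mul_le {f g : X → ℝ} (hf : f ∈ A) (hg : g ∈ A) :
    ∀ᵐ x ∂m, (Γ (f * g) (f * g)).rnDeriv m x ≤
        2 * (f x ^ 2 * (Γ g g).rnDeriv m x) + 2 * (g x ^ 2 * (Γ f f).rnDeriv m x) ∧
      f x ^ 2 * (Γ g g).rnDeriv m x ≤
        2 * (Γ (f * g) (f * g)).rnDeriv m x + 2 * (g x ^ 2 * (Γ f f).rnDeriv m x) := by
  filter_upwards [hΓ.rnDeriv_mul_self hm hf hg, hΓ.rnDeriv_sq_le hm hf hg] with x h1 h2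
  rw [h1]
  -- The quadratic form in the densities is evaluated at `(g, -f)` for the upper bound and at `(2 g,
  -- f)` for the lower bound; each absorbs the mixed term exactly.
  have h3 := h2 (g x) (- f x)
  have h4 := h2 (2 * g x) (f x)
  constructor <;> linarith

end IsLocalForm

/-! ### Small polynomials with derivative one at the origin -/

/-- In `k + 1` independent trials with success probability `s`, exactly one success is no more
likely than at least one. -/
theorem succ_mul_mul_pow_le {s : ℝ} (h0 : 0 ≤ s) (h1 : s ≤ 1) (k : ℕ) :
    (k + 1) * s * (1 - s) ^ k ≤ 1 - (1 - s) ^ (k + 1) := by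
  have hr : 0 ≤ 1 - s := by linarith
  induction k with
  | zero => simp
  | succ k ih =>
    have h2 : (1 - s) ^ (k + 1) ≤ 1 := pow_le_one₀ hr (by linarith)
    have h3 := mul_le_mul_of_nonneg_left ih hr
    have h4 := mul_le_mul_of_nonneg_left h2 h0
    push_cast
    rw [pow_succ (1 - s) (k + 1)]
    rw [pow_succ] at h3 h4 ⊢
    nlinarith

open Polynomial in
/-- Polynomials `P = X q` that are uniformly small on a given interval, with bounded derivatives
that are close to `1` near zero, uniformly with respect to the interval. -/
theorem exists_small_polynomial {ε : ℝ} (hε : 0 < ε) :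
    ∃ C : ℝ, ∀ M : ℝ, ∃ q : ℝ[X], ∀ t, |t| ≤ M →
      |(X * q).eval t| ≤ ε ∧ |(X * q).eval t| ≤ |t| ∧
      |(derivative (X * q)).eval t| ≤ 2 ∧ |(derivative (X * q)).eval t - 1| ≤ C * t ^ 2 := by
  refine ⟨3 * (1 / ε ^ 2 + 2), fun M₀ => ?_⟩
  set M := max M₀ 1
  have hM1 : 1 ≤ M := le_max_right _ _
  have hM : 0 < M := by linarith
  set K := ⌈M ^ 2 / ε ^ 2⌉₊
  have hK1 : M ^ 2 / ε ^ 2 ≤ K := Nat.le_ceil _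
  have hK2 : (K : ℝ) < M ^ 2 / ε ^ 2 + 1 := Nat.ceil_lt_add_one (by positivity)
  -- So `P t = t (1 - t² / M²) ^ (K + 1)` with `K` about `M² / ε²`. In `|P' - 1| ≤ 3 (K + 1) t² /
  -- M²` the factor `M²` of `K` cancels, and `M ≥ 1` absorbs the rounding; this makes the constant
  -- independent of the interval.
  refine ⟨(1 - C (M ^ 2)⁻¹ * X ^ 2) ^ (K + 1), fun t ht₀ => ?_⟩
  have ht : |t| ≤ M := ht₀.trans (le_max_left _ _)
  set s := (M ^ 2)⁻¹ * t ^ 2 with hs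
  have hs0 : 0 ≤ s := by positivity
  have ht2 : t ^ 2 ≤ M ^ 2 := sq_le_sq' (abs_le.1 ht).1 (abs_le.1 ht).2
  have hs1 : s ≤ 1 := by
    rw [hs, inv_mul_le_iff₀ (by positivity), mul_one]; exact ht2
  have hr : 0 ≤ 1 - s := by linarith
  have hev : (X * (1 - C (M ^ 2)⁻¹ * X ^ 2) ^ (K + 1)).eval t = t * (1 - s) ^ (K + 1) := by
    simp [hs]
  have hder : (derivative (X * (1 - C (M ^ 2)⁻¹ * X ^ 2) ^ (K + 1))).eval t =
      (1 - s) ^ (K + 1) - 2 * ((K + 1) * s * (1 - s) ^ K) := by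
    simp [derivative_pow, hs]
    ring
  have hpow1 : (1 - s) ^ (K + 1) ≤ 1 := pow_le_one₀ hr (by linarith)
  have hpow0 : 0 ≤ (1 - s) ^ (K + 1) := by positivity
  have hb := succ_mul_mul_pow_le hs0 hs1 K
  have hb0 : 0 ≤ (K + 1) * s * (1 - s) ^ K := by positivity
  have hbern : 1 - (K + 1) * s ≤ (1 - s) ^ (K + 1) := by
    have := one_add_mul_le_pow (show (-2 : ℝ) ≤ -s by linarith) (K + 1)
    push_cast at this
    rw [← sub_eq_add_neg] at this
    linarith
  rw [hev, hder]
  refine ⟨?_, ?_, ?_, ?_⟩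
  · apply abs_le_of_sq_le_sq _ hε.le
    -- Since `P² = M² s (1 - s) ^ (2 (K + 1))`, the single-success bound for `2 (K + 1) + 1` trials,
    -- together with `K ≥ M² / ε²`, gives `P² ≤ ε²`.
    have hb2 := succ_mul_mul_pow_le hs0 hs1 (2 * (K + 1))
    have h5 : 0 ≤ (1 - s) ^ (2 * (K + 1) + 1) := by positivity
    have h6 : 0 ≤ s * (1 - s) ^ (2 * (K + 1)) := by positivity
    have h7 : (K : ℝ) * (s * (1 - s) ^ (2 * (K + 1))) ≤ 1 := by
      push_cast at hb2
      nlinarith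
    have h8 : t ^ 2 = M ^ 2 * s := by rw [hs]; field_simp
    rw [mul_pow, ← pow_mul, mul_comm (K + 1) 2, h8, mul_assoc]
    have h9 : M ^ 2 / ε ^ 2 * (s * (1 - s) ^ (2 * (K + 1))) ≤ 1 :=
      (mul_le_mul_of_nonneg_right hK1 h6).trans h7
    rw [div_mul_eq_mul_div, div_le_one (by positivity)] at h9
    exact h9
  · rw [abs_mul, abs_of_nonneg hpow0]
    exact mul_le_of_le_one_right (abs_nonneg t) hpow1
  · rw [abs_le]
    constructor <;> linarith
  · have h3 : (K + 1) * s ≤ (1 / ε ^ 2 + 2) * t ^ 2 := by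
      rw [hs, ← mul_assoc]
      apply mul_le_mul_of_nonneg_right _ (sq_nonneg t)
      rw [← div_eq_mul_inv, div_le_iff₀ (by positivity)]
      have h4 : (1 / ε ^ 2 + 2) * M ^ 2 = M ^ 2 / ε ^ 2 + 2 * M ^ 2 := by ring
      rw [h4]
      nlinarith
    have h4 : (K + 1) * s * (1 - s) ^ K ≤ (K + 1) * s :=
      mul_le_of_le_one_right (by positivity) (pow_le_one₀ hr (by linarith))
    rw [abs_le]
    constructor <;> nlinarith [sq_nonneg t]

open Polynomial in
/-- The mean value inequality for a polynomial on a centered interval. -/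
theorem abs_eval_sub_le_of_derivative {p : ℝ[X]} {C M : ℝ}
    (h : ∀ t, |t| ≤ M → |(derivative p).eval t| ≤ C) {a b : ℝ} (ha : |a| ≤ M) (hb : |b| ≤ M) :
    |p.eval a - p.eval b| ≤ C * |a - b| := by
  have := (convex_Icc (-M) M).norm_image_sub_le_of_norm_hasDerivWithin_le
    (f := fun t => p.eval t) (f' := fun t => (derivative p).eval t) (C := C)
    (fun t _ => (p.hasDerivAt t).hasDerivWithinAt) (fun t ht => h t (abs_le.2 ht))
    (abs_le.1 hb) (abs_le.1 ha)
  simpa [Real.norm_eq_abs] using this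

/-! ### Jump and killing parts, and the energy measure -/

/-- Fatou's lemma for the seminorm of `L²`. -/
theorem tendsto_integral_sq_of_cauchy {Z : Type*} {mZ : MeasurableSpace Z} {J : Measure Z}
    (d : ℕ → Z → ℝ) (hd : ∀ i j, Integrable (fun z => (d i z - d j z) ^ 2) J)
    (hdi : ∀ i, Integrable (fun z => d i z ^ 2) J)
    (hcau : ∀ ε > 0, ∃ N, ∀ i ≥ N, ∀ j ≥ N, ∫ z, (d i z - d j z) ^ 2 ∂J < ε)
    (hlim : ∀ᵐ z ∂J, Tendsto (fun n => d n z) atTop (𝓝 0)) :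
    Tendsto (fun n => ∫ z, d n z ^ 2 ∂J) atTop (𝓝 0) := by
  rw [Metric.tendsto_atTop]
  intro ε hε
  obtain ⟨N, hN⟩ := hcau (ε / 2) (by positivity)
  refine ⟨N, fun n hn => ?_⟩
  rw [Real.dist_eq, sub_zero, abs_of_nonneg (integral_nonneg fun z => sq_nonneg _)]
  have h1 : ∫⁻ z, ENNReal.ofReal (d n z ^ 2) ∂J ≤
      liminf (fun k => ∫⁻ z, ENNReal.ofReal ((d n z - d k z) ^ 2) ∂J) atTop := by
    refine le_trans (le_of_eq (lintegral_congr_ae ?_)) (lintegral_liminf_le' fun k =>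
      (hd n k).aestronglyMeasurable.aemeasurable.ennreal_ofReal)
    filter_upwards [hlim] with z hz
    have h2 : Tendsto (fun k => ENNReal.ofReal ((d n z - d k z) ^ 2)) atTop
        (𝓝 (ENNReal.ofReal ((d n z - 0) ^ 2))) :=
      (ENNReal.continuous_ofReal.tendsto _).comp ((tendsto_const_nhds.sub hz).pow 2)
    rw [sub_zero] at h2
    exact h2.liminf_eq.symm
  have h2 : liminf (fun k => ∫⁻ z, ENNReal.ofReal ((d n z - d k z) ^ 2) ∂J) atTop ≤
      ENNReal.ofReal (ε / 2) := by
    refine liminf_le_of_frequently_le' (Eventually.frequently ?_)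
    filter_upwards [eventually_ge_atTop N] with k hk
    rw [← ofReal_integral_eq_lintegral_ofReal (hd n k) (ae_of_all _ fun z => sq_nonneg _)]
    exact ENNReal.ofReal_le_ofReal (hN n hn k hk).le
  rw [← ofReal_integral_eq_lintegral_ofReal (hdi n) (ae_of_all _ fun z => sq_nonneg _)] at h1
  have h3 := (ENNReal.ofReal_le_ofReal_iff (by positivity)).1 (h1.trans h2)
  linarith

/-- The bilinear form `E` on the algebra `A` is the sum of a local, a jump and a killing part. The
jump part lives on a space `Z` with two maps `a`, `b` to `X`. -/
structure IsDecomposition {X Z : Type*} {mX : MeasurableSpace X} {mZ : MeasurableSpace Z}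
    (A : Submodule ℝ (X → ℝ)) (E : A →ₗ[ℝ] A →ₗ[ℝ] ℝ) (Γ : (X → ℝ) → (X → ℝ) → SignedMeasure X)
    (J : Measure Z) (a b : Z → X) (κ : Measure X) : Prop where
  isLocalForm : IsLocalForm A Γ
  generated : mX = ⨆ f ∈ A, MeasurableSpace.comap f inferInstance
  jump_measurable : ∀ f ∈ A, Measurable fun z => f (a z) - f (b z)
  jump_measurable_left : ∀ f ∈ A, ∀ h ∈ A, Measurable fun z => h (a z) * (f (a z) - f (b z))
  jump_measurable_right : ∀ f ∈ A, ∀ h ∈ A, Measurable fun z => h (b z) * (f (a z) - f (b z))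
  jump_integrable : ∀ f ∈ A, ∀ g ∈ A,
    Integrable (fun z => (f (a z) - f (b z)) * (g (a z) - g (b z))) J
  kill_integrable : ∀ f ∈ A, Integrable f κ
  decomp : ∀ f g : A, E f g = Γ f g Set.univ +
    ∫ z, ((f : X → ℝ) (a z) - (f : X → ℝ) (b z)) * ((g : X → ℝ) (a z) - (g : X → ℝ) (b z)) ∂J +
    ∫ x, (f : X → ℝ) x * (g : X → ℝ) x ∂κ

/-- The image under `c` of the measure with density `w ^ 2`, where `c` need only be measurable on
`{w ≠ 0}`. -/
theorem exists_marginal {X Z : Type*} {mX : MeasurableSpace X} {mZ : MeasurableSpace Z}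
    {A : Submodule ℝ (X → ℝ)} (hA : mX = ⨆ f ∈ A, MeasurableSpace.comap f inferInstance)
    {J : Measure Z} {c : Z → X} {w : Z → ℝ} (hw : Measurable w)
    (hwi : Integrable (fun z => w z ^ 2) J) (hc : ∀ h ∈ A, Measurable fun z => h (c z) * w z) :
    ∃ ρ : Measure X, IsFiniteMeasure ρ ∧ (∀ h ∈ A, ∫ x, h x ∂ρ = ∫ z, h (c z) * w z ^ 2 ∂J) ∧
      ∀ N, MeasurableSet N → ρ N = 0 → ∀ᵐ z ∂J, w z ≠ 0 → c z ∉ N := by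
  -- A point `x₀` is needed to redefine `c` on `{w = 0}`, where nothing is known about its
  -- measurability; the density `w²` makes that set negligible.
  rcases isEmpty_or_nonempty X with hX | ⟨⟨x₀⟩⟩
  · have : IsEmpty Z := ⟨fun z => hX.elim (c z)⟩
    exact ⟨0, inferInstance, fun h _ => by simp [integral_of_isEmpty],
      fun N _ _ => ae_of_all _ fun z => hX.elim (c z)⟩
  classical
  have hS : MeasurableSet {z | w z ≠ 0} := (hw (measurableSet_singleton 0)).compl
  set c' : Z → X := fun z => if w z ≠ 0 then c z else x₀ with hc'
  have hcc' : ∀ z, w z ≠ 0 → c' z = c z := fun z hz => if_pos hz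
  have hm : Measurable c' := by
    rw [measurable_iff_comap_le, hA]
    simp only [MeasurableSpace.comap_iSup, iSup_le_iff, MeasurableSpace.comap_comp]
    intro h hh
    rw [← measurable_iff_comap_le]
    have : h ∘ c' = fun z => if w z ≠ 0 then h (c z) * w z / w z else h x₀ := by
      ext z
      by_cases hz : w z = 0
      · simp [hc', hz]
      · simp [hc', hz]
    rw [this]
    exact Measurable.ite hS ((hc h hh).div hw) measurable_const
  have hd : Measurable fun z => ENNReal.ofReal (w z ^ 2) := (hw.pow_const 2).ennreal_ofReal
  have hfin : IsFiniteMeasure (J.withDensity fun z => ENNReal.ofReal (w z ^ 2)) :=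
    isFiniteMeasure_withDensity_ofReal hwi.2
  refine ⟨(J.withDensity fun z => ENNReal.ofReal (w z ^ 2)).map c', inferInstance, ?_, ?_⟩
  · intro h hh
    have hhm : Measurable h := by
      rw [measurable_iff_comap_le, hA]
      exact le_iSup₂_of_le h hh le_rfl
    rw [integral_map hm.aemeasurable hhm.aestronglyMeasurable,
      integral_withDensity_eq_integral_toReal_smul hd (ae_of_all _ fun _ => ENNReal.ofReal_lt_top)]
    refine integral_congr_ae (ae_of_all _ fun z => ?_)
    simp only [smul_eq_mul, ENNReal.toReal_ofReal (sq_nonneg (w z))]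
    by_cases hz : w z = 0
    · simp [hz]
    · rw [hcc' z hz, mul_comm]
  · intro N hN h0
    rw [Measure.map_apply hm hN, withDensity_apply _ (hm hN),
      lintegral_eq_zero_iff hd, EventuallyEq, ae_restrict_iff' (hm hN)] at h0
    filter_upwards [h0] with z hz hwz hcz
    have h1 := hz (by rw [Set.mem_preimage, hcc' z hwz]; exact hcz)
    have h2 : 0 < w z ^ 2 := by positivity
    simp only [Pi.zero_apply, ENNReal.ofReal_eq_zero] at h1
    linarith

namespace IsDecomposition

variable {X Z : Type*} {mX : MeasurableSpace X} {mZ : MeasurableSpace Z}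
  {A : Submodule ℝ (X → ℝ)} {E : A →ₗ[ℝ] A →ₗ[ℝ] ℝ} {Γ : (X → ℝ) → (X → ℝ) → SignedMeasure X}
  {J : Measure Z} {a b : Z → X} {κ : Measure X}

theorem jump_sq_integrable (hD : IsDecomposition A E Γ J a b κ) {f : X → ℝ} (hf : f ∈ A) :
    Integrable (fun z => (f (a z) - f (b z)) ^ 2) J := by
  simpa only [sq] using hD.jump_integrable f hf f hf

theorem kill_sq_integrable (hD : IsDecomposition A E Γ J a b κ) {f : X → ℝ} (hf : f ∈ A) :
    Integrable (fun x => f x ^ 2) κ := by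
  simpa only [sq, Pi.mul_def] using hD.kill_integrable _ (hD.isLocalForm.mul_mem f hf f hf)

theorem integrable_mul_jump_left (hD : IsDecomposition A E Γ J a b κ) {f h : X → ℝ}
    (hf : f ∈ A) (hh : h ∈ A) : Integrable (fun z => h (a z) * (f (a z) - f (b z)) ^ 2) J := by
  obtain ⟨C, hC⟩ := hD.isLocalForm.bdd h hh
  refine ((hD.jump_sq_integrable hf).const_mul C).mono ?_ (ae_of_all _ fun z => ?_)
  · have := (hD.jump_measurable_left f hf h hh).mul (hD.jump_measurable f hf)
    simp only [Pi.mul_def, mul_assoc, ← sq] at this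
    exact this.aestronglyMeasurable
  · rw [norm_mul, norm_mul]
    exact mul_le_mul_of_nonneg_right ((hC _).trans (le_abs_self C)) (norm_nonneg _)

theorem integrable_mul_jump_right (hD : IsDecomposition A E Γ J a b κ) {f h : X → ℝ}
    (hf : f ∈ A) (hh : h ∈ A) : Integrable (fun z => h (b z) * (f (a z) - f (b z)) ^ 2) J := by
  obtain ⟨C, hC⟩ := hD.isLocalForm.bdd h hh
  refine ((hD.jump_sq_integrable hf).const_mul C).mono ?_ (ae_of_all _ fun z => ?_)
  · have := (hD.jump_measurable_right f hf h hh).mul (hD.jump_measurable f hf)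
    simp only [Pi.mul_def, mul_assoc, ← sq] at this
    exact this.aestronglyMeasurable
  · rw [norm_mul, norm_mul]
    exact mul_le_mul_of_nonneg_right ((hC _).trans (le_abs_self C)) (norm_nonneg _)

/-- The defining functional of the energy measure of `f`. -/
theorem energy_identity (hD : IsDecomposition A E Γ J a b κ) {f h : X → ℝ}
    (hf : f ∈ A) (hh : h ∈ A) :
    E ⟨f * h, hD.isLocalForm.mul_mem f hf h hh⟩ ⟨f, hf⟩ -
      1 / 2 * E ⟨f * f, hD.isLocalForm.mul_mem f hf f hf⟩ ⟨h, hh⟩ =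
    (Γ f f).integral h (ContinuousLinearMap.lsmul ℝ ℝ) +
      1 / 2 * (∫ z, h (a z) * (f (a z) - f (b z)) ^ 2 ∂J +
        ∫ z, h (b z) * (f (a z) - f (b z)) ^ 2 ∂J) + 1 / 2 * ∫ x, h x * f x ^ 2 ∂κ := by
  have hΓ := hD.isLocalForm
  have hfh := hΓ.mul_mem f hf h hh
  have hff := hΓ.mul_mem f hf f hf
  rw [hD.decomp, hD.decomp]
  simp only
  -- By the product rule and symmetry, `f Γ(h, f) + h Γ(f, f) - f Γ(f, h) = h Γ(f, f)`.
  have h1 : Γ (f * h) f Set.univ - 1 / 2 * Γ (f * f) h Set.univ =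
      (Γ f f).integral h (ContinuousLinearMap.lsmul ℝ ℝ) := by
    rw [hΓ.mul f hf h hh f hf, hΓ.mul f hf f hf h hh]
    simp only [_root_.add_apply, VectorMeasure.withDensity_apply_univ]
    rw [hΓ.symm h hh f hf]
    ring
  -- Pointwise, the integrands combine to `½ (h(a) + h(b)) (f(a) - f(b))²`.
  have h2 : ∫ z, ((f * h) (a z) - (f * h) (b z)) * (f (a z) - f (b z)) ∂J -
      1 / 2 * ∫ z, ((f * f) (a z) - (f * f) (b z)) * (h (a z) - h (b z)) ∂J =
      1 / 2 * (∫ z, h (a z) * (f (a z) - f (b z)) ^ 2 ∂J +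
        ∫ z, h (b z) * (f (a z) - f (b z)) ^ 2 ∂J) := by
    rw [← integral_add (hD.integrable_mul_jump_left hf hh) (hD.integrable_mul_jump_right hf hh),
      ← integral_const_mul, ← integral_const_mul, ← integral_sub (hD.jump_integrable _ hfh f hf)
        ((hD.jump_integrable _ hff h hh).const_mul _)]
    refine integral_congr_ae (ae_of_all _ fun z => ?_)
    simp only [Pi.mul_apply]
    ring
  have h3 : ∫ x, (f * h) x * f x ∂κ - 1 / 2 * ∫ x, (f * f) x * h x ∂κ =
      1 / 2 * ∫ x, h x * f x ^ 2 ∂κ := by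
    have hi1 : Integrable (fun x => (f * h) x * f x) κ :=
      hD.kill_integrable _ (hΓ.mul_mem _ hfh f hf)
    have hi2 : Integrable (fun x => (f * f) x * h x) κ :=
      hD.kill_integrable _ (hΓ.mul_mem _ hff h hh)
    rw [← integral_const_mul, ← integral_const_mul, ← integral_sub hi1 (hi2.const_mul _)]
    refine integral_congr_ae (ae_of_all _ fun x => ?_)
    simp only [Pi.mul_apply]
    ring
  linarith

/-- The energy measure of `f` exists, and its null sets are null sets for all parts of the form. -/
theorem exists_energyMeasure (hD : IsDecomposition A E Γ J a b κ) {f : X → ℝ} (hf : f ∈ A) :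
    ∃ ν : Measure X, IsFiniteMeasure ν ∧
      (∀ h (hh : h ∈ A), E ⟨f * h, hD.isLocalForm.mul_mem f hf h hh⟩ ⟨f, hf⟩ -
        1 / 2 * E ⟨f * f, hD.isLocalForm.mul_mem f hf f hf⟩ ⟨h, hh⟩ = ∫ x, h x ∂ν) ∧
      ∀ N, MeasurableSet N → ν N = 0 → Γ f f N = 0 ∧
        (∀ᵐ z ∂J, f (a z) - f (b z) ≠ 0 → a z ∉ N ∧ b z ∉ N) ∧
        ∀ᵐ x ∂κ, f x ≠ 0 → x ∉ N := by
  have hΓ := hD.isLocalForm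
  have hpos : VectorMeasure.restrict 0 Set.univ ≤ VectorMeasure.restrict (Γ f f) Set.univ := by
    rw [VectorMeasure.restrict_univ, VectorMeasure.restrict_univ, VectorMeasure.le_iff']
    exact hΓ.nonneg f hf
  obtain ⟨ρa, hρa, ha1, ha2⟩ := exists_marginal hD.generated (hD.jump_measurable f hf)
    (hD.jump_sq_integrable hf) (hD.jump_measurable_left f hf)
  obtain ⟨ρb, hρb, hb1, hb2⟩ := exists_marginal hD.generated (hD.jump_measurable f hf)
    (hD.jump_sq_integrable hf) (hD.jump_measurable_right f hf)
  obtain ⟨ρk, hρk, hk1, hk2⟩ := exists_marginal (c := id) hD.generated (hΓ.measurable f hf)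
    (hD.kill_sq_integrable hf) (fun h hh => (hΓ.measurable h hh).mul (hΓ.measurable f hf))
  set ρc := (Γ f f).toMeasureOfZeroLE Set.univ MeasurableSet.univ hpos with hρc
  have hc : IsFiniteMeasure ρc := inferInstance
  have hcs : ρc.toSignedMeasure = Γ f f := by
    ext s hs
    rw [Measure.toSignedMeasure_apply_measurable hs, hρc,
      SignedMeasure.toMeasureOfZeroLE_real_apply _ hpos MeasurableSet.univ hs, Set.univ_inter]
  have hflip : (ContinuousLinearMap.lsmul ℝ ℝ : ℝ →L[ℝ] ℝ →L[ℝ] ℝ) =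
      (ContinuousLinearMap.lsmul ℝ ℝ : ℝ →L[ℝ] ℝ →L[ℝ] ℝ).flip := by
    ext; simp
  -- All summands are nonnegative, so a null set of the sum is a null set of each of them. This is
  -- the only way in which energy dominance is exploited.
  refine ⟨ρc + (2⁻¹ : NNReal) • (ρa + ρb) + (2⁻¹ : NNReal) • ρk, inferInstance, ?_, ?_⟩
  · intro h hh
    obtain ⟨C, hC⟩ := hΓ.bdd h hh
    have hint : ∀ ρ : Measure X, ∀ [IsFiniteMeasure ρ], Integrable h ρ := fun ρ _ =>
      Integrable.of_bound (hΓ.measurable h hh).aestronglyMeasurable C (ae_of_all _ hC)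
    rw [hD.energy_identity hf hh, integral_add_measure (hint _) (hint _),
      integral_add_measure (hint _) (hint _), integral_smul_nnreal_measure,
      integral_smul_nnreal_measure, integral_add_measure (hint _) (hint _), ha1 h hh, hb1 h hh,
      hk1 h hh, hflip, ← hcs, VectorMeasure.integral_toSignedMeasure]
    simp only [NNReal.smul_def, NNReal.coe_inv, NNReal.coe_ofNat, smul_eq_mul, id_eq]
    ring
  · intro N hN h0
    simp only [Measure.add_apply, Measure.smul_apply, add_eq_zero, smul_eq_zero] at h0
    have h2 : (2⁻¹ : NNReal) ≠ 0 := by positivity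
    obtain ⟨⟨h0c, h0ab⟩, h0k⟩ := h0
    have h0ab := h0ab.resolve_left h2
    refine ⟨?_, ?_, hk2 N hN (h0k.resolve_left h2)⟩
    · rw [← hcs, Measure.toSignedMeasure_apply_measurable hN, measureReal_def, h0c,
        ENNReal.toReal_zero]
    · filter_upwards [ha2 N hN h0ab.1, hb2 N hN h0ab.2] with z h1 h2 h3
      exact ⟨h1 h3, h2 h3⟩

end IsDecomposition

/-! ### Vanishing of energies along Cauchy sequences -/

theorem IsLocalForm.rnDeriv_add_le {X : Type*} {mX : MeasurableSpace X} {A : Submodule ℝ (X → ℝ)}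
    {Γ : (X → ℝ) → (X → ℝ) → SignedMeasure X} {m : Measure X} [IsFiniteMeasure m]
    (hΓ : IsLocalForm A Γ) (hm : ∀ f ∈ A, Γ f f ≪ᵥ m.toENNRealVectorMeasure)
    {f g : X → ℝ} (hf : f ∈ A) (hg : g ∈ A) :
    ∀ᵐ x ∂m, (Γ (f + g) (f + g)).rnDeriv m x ≤
      2 * (Γ f f).rnDeriv m x + 2 * (Γ g g).rnDeriv m x := by
  have hs := A.add_mem hf hg
  filter_upwards [hΓ.rnDeriv_add hm hf hg hs, hΓ.rnDeriv_add hm hf hg hf,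
    hΓ.rnDeriv_add hm hf hg hg, hΓ.rnDeriv_sq_le hm hf hg] with x h1 h2 h3 h4
  rw [h1, Pi.add_apply, hΓ.symm f hf _ hs, hΓ.symm g hg _ hs, h2, h3, Pi.add_apply, Pi.add_apply,
    hΓ.symm g hg f hf]
  have := h4 1 (-1)
  linarith

/-- Null sets of `m` are null sets for all parts of the form. -/
def IsDominatedBy {X Z : Type*} {mX : MeasurableSpace X} {mZ : MeasurableSpace Z}
    (A : Submodule ℝ (X → ℝ)) (Γ : (X → ℝ) → (X → ℝ) → SignedMeasure X)
    (J : Measure Z) (a b : Z → X) (κ : Measure X) (m : Measure X) : Prop :=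
  ∀ f ∈ A, ∀ N, MeasurableSet N → m N = 0 → Γ f f N = 0 ∧
    (∀ᵐ z ∂J, f (a z) - f (b z) ≠ 0 → a z ∉ N ∧ b z ∉ N) ∧ ∀ᵐ x ∂κ, f x ≠ 0 → x ∉ N

theorem IsDominatedBy.absolutelyContinuous {X Z : Type*} {mX : MeasurableSpace X}
    {mZ : MeasurableSpace Z}
    {A : Submodule ℝ (X → ℝ)} {Γ : (X → ℝ) → (X → ℝ) → SignedMeasure X}
    {J : Measure Z} {a b : Z → X} {κ : Measure X} {m : Measure X}
    (h : IsDominatedBy A Γ J a b κ m) : ∀ f ∈ A, Γ f f ≪ᵥ m.toENNRealVectorMeasure := by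
  intro f hf
  refine VectorMeasure.AbsolutelyContinuous.mk fun s hs h0 => (h f hf s hs ?_).1
  rwa [Measure.toENNRealVectorMeasure_apply_measurable hs] at h0

namespace IsDecomposition

variable {X Z : Type*} {mX : MeasurableSpace X} {mZ : MeasurableSpace Z}
  {A : Submodule ℝ (X → ℝ)} {E : A →ₗ[ℝ] A →ₗ[ℝ] ℝ} {Γ : (X → ℝ) → (X → ℝ) → SignedMeasure X}
  {J : Measure Z} {a b : Z → X} {κ m : Measure X} [IsFiniteMeasure m]

section

variable (hD : IsDecomposition A E Γ J a b κ) (hm : IsDominatedBy A Γ J a b κ m)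
include hD hm

theorem apply_self (f : A) : E f f = ∫ x, (Γ f f).rnDeriv m x ∂m +
    ∫ z, ((f : X → ℝ) (a z) - (f : X → ℝ) (b z)) ^ 2 ∂J + ∫ x, (f : X → ℝ) x ^ 2 ∂κ := by
  rw [hD.decomp, hD.isLocalForm.apply_univ hm.absolutelyContinuous f.2 f.2]
  simp only [sq]

theorem integral_rnDeriv_nonneg (f : A) : 0 ≤ ∫ x, (Γ f f).rnDeriv m x ∂m :=
  integral_nonneg_of_ae (hD.isLocalForm.rnDeriv_nonneg hm.absolutelyContinuous f.2)

theorem local_le (f : A) : ∫ x, (Γ f f).rnDeriv m x ∂m ≤ E f f := by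
  rw [hD.apply_self hm f]
  have h1 : 0 ≤ ∫ z, ((f : X → ℝ) (a z) - (f : X → ℝ) (b z)) ^ 2 ∂J :=
    integral_nonneg fun _ => sq_nonneg _
  have h2 : 0 ≤ ∫ x, (f : X → ℝ) x ^ 2 ∂κ := integral_nonneg fun _ => sq_nonneg _
  linarith

theorem jump_le (f : A) : ∫ z, ((f : X → ℝ) (a z) - (f : X → ℝ) (b z)) ^ 2 ∂J ≤ E f f := by
  rw [hD.apply_self hm f]
  have h1 := hD.integral_rnDeriv_nonneg hm f
  have h2 : 0 ≤ ∫ x, (f : X → ℝ) x ^ 2 ∂κ := integral_nonneg fun _ => sq_nonneg _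
  linarith

theorem kill_le (f : A) : ∫ x, (f : X → ℝ) x ^ 2 ∂κ ≤ E f f := by
  rw [hD.apply_self hm f]
  have h1 := hD.integral_rnDeriv_nonneg hm f
  have h2 : 0 ≤ ∫ z, ((f : X → ℝ) (a z) - (f : X → ℝ) (b z)) ^ 2 ∂J :=
    integral_nonneg fun _ => sq_nonneg _
  linarith

/-- The jump and killing energies are squared `L²` norms dominated by `E`, so the differences and
the values of `u n` are Cauchy there. Domination turns `m`-a.e. convergence into almost everywhere
convergence for `J` and `κ`, and Fatou's lemma concludes. -/
theorem jump_kill_tendsto {u : ℕ → A} (hu : QCauchy E u)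
    (hlim : ∀ᵐ x ∂m, Tendsto (fun n => (u n : X → ℝ) x) atTop (𝓝 0)) :
    Tendsto (fun n => ∫ z, ((u n : X → ℝ) (a z) - (u n : X → ℝ) (b z)) ^ 2 ∂J) atTop (𝓝 0) ∧
      Tendsto (fun n => ∫ x, (u n : X → ℝ) x ^ 2 ∂κ) atTop (𝓝 0) := by
  obtain ⟨N, hN, hNm, hN0⟩ := exists_measurable_superset_of_null hlim
  have hlim' : ∀ x ∉ N, Tendsto (fun n => (u n : X → ℝ) x) atTop (𝓝 0) := by
    intro x hx
    by_contra h
    exact hx (hN h)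
  have hsub : ∀ i j z, ((u i : X → ℝ) (a z) - (u i : X → ℝ) (b z) -
      ((u j : X → ℝ) (a z) - (u j : X → ℝ) (b z))) =
      ((u i - u j : A) : X → ℝ) (a z) - ((u i - u j : A) : X → ℝ) (b z) := by
    intro i j z
    simp only [Submodule.coe_sub, Pi.sub_apply]
    ring
  constructor
  · apply tendsto_integral_sq_of_cauchy fun n z => (u n : X → ℝ) (a z) - (u n : X → ℝ) (b z)
    · intro i j
      simp only [hsub]
      exact hD.jump_sq_integrable (u i - u j).2
    · exact fun i => hD.jump_sq_integrable (u i).2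
    · intro ε hε
      obtain ⟨M, hM⟩ := hu ε hε
      refine ⟨M, fun i hi j hj => ?_⟩
      simp only [hsub]
      exact (hD.jump_le hm (u i - u j)).trans_lt (hM i hi j hj)
    · filter_upwards [ae_all_iff.2 fun n => (hm _ (u n).2 N hNm hN0).2.1] with z hz
      -- Domination says nothing where the difference vanishes. But if one difference is nonzero at
      -- `z`, both endpoints avoid `N`, and then the whole sequence converges at them.
      by_cases h : ∀ n, (u n : X → ℝ) (a z) - (u n : X → ℝ) (b z) = 0
      · simp only [h]
        exact tendsto_const_nhds
      · obtain ⟨n, hn⟩ := not_forall.1 h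
        simpa using (hlim' _ (hz n hn).1).sub (hlim' _ (hz n hn).2)
  · apply tendsto_integral_sq_of_cauchy fun n x => (u n : X → ℝ) x
    · exact fun i j => hD.kill_sq_integrable (u i - u j).2
    · exact fun i => hD.kill_sq_integrable (u i).2
    · intro ε hε
      obtain ⟨M, hM⟩ := hu ε hε
      exact ⟨M, fun i hi j hj => (hD.kill_le hm (u i - u j)).trans_lt (hM i hi j hj)⟩
    · filter_upwards [ae_all_iff.2 fun n => (hm _ (u n).2 N hNm hN0).2.2] with x hx
      by_cases h : ∀ n, (u n : X → ℝ) x = 0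
      · simp only [h]
        exact tendsto_const_nhds
      · obtain ⟨n, hn⟩ := not_forall.1 h
        exact hlim' _ (hx n hn)

omit hD hm [IsFiniteMeasure m] in
theorem integrable_weight {θ : X → ℝ} (hθ : Measurable θ) {K : ℝ} (hK : ∀ x, |θ x| ≤ K)
    (s : SignedMeasure X) : Integrable (fun x => θ x * s.rnDeriv m x) m :=
  (SignedMeasure.integrable_rnDeriv _ _).bdd_mul hθ.aestronglyMeasurable (ae_of_all _ hK)

/-- Subadditivity of the weighted local energy. -/
theorem weighted_le {θ : X → ℝ} (hθ : Measurable θ) {K : ℝ} (h0 : ∀ x, 0 ≤ θ x)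
    (hK : ∀ x, θ x ≤ K) (f g : A) : ∫ x, θ x * (Γ f f).rnDeriv m x ∂m ≤
      2 * K * E (f - g) (f - g) + 2 * ∫ x, θ x * (Γ g g).rnDeriv m x ∂m := by
  have hθK : ∀ x, |θ x| ≤ K := fun x => by rw [abs_of_nonneg (h0 x)]; exact hK x
  have hac := hm.absolutelyContinuous
  have hΓ := hD.isLocalForm
  have hi : ∀ s : SignedMeasure X, Integrable (fun x => θ x * s.rnDeriv m x) m :=
    fun s => integrable_weight hθ hθK s
  have h1 : ∫ x, θ x * (Γ f f).rnDeriv m x ∂m ≤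
      ∫ x, (2 * K * (Γ (f - g : A) (f - g : A)).rnDeriv m x +
        2 * (θ x * (Γ g g).rnDeriv m x)) ∂m := by
    refine integral_mono_ae (hi _)
      (((SignedMeasure.integrable_rnDeriv _ _).const_mul _).add ((hi _).const_mul 2)) ?_
    have h2 := hΓ.rnDeriv_add_le hac (f - g).2 g.2
    have h3 : ((f - g : A) : X → ℝ) + g = f := by simp
    rw [h3] at h2
    filter_upwards [h2, hΓ.rnDeriv_nonneg hac (f - g).2] with x h4 h5
    have h6 := mul_le_mul_of_nonneg_left h4 (h0 x)
    have h7 := mul_le_mul_of_nonneg_right (hK x) h5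
    linarith
  rw [integral_add ((SignedMeasure.integrable_rnDeriv _ _).const_mul _) ((hi _).const_mul 2),
    integral_const_mul, integral_const_mul] at h1
  -- The bound `K` is known to be nonnegative only when `X` has a point.
  rcases isEmpty_or_nonempty X with hX | ⟨⟨x₀⟩⟩
  · have h2 : ∀ f : A, E f f = 0 := by
      intro f
      have : f = 0 := Subtype.ext (funext fun x => hX.elim x)
      simp [this]
    rw [h2]
    simp [integral_of_isEmpty]
  have hK0 : 0 ≤ K := (h0 x₀).trans (hK x₀)
  have h2 := mul_le_mul_of_nonneg_left (hD.local_le hm (f - g)) (show 0 ≤ 2 * K by linarith)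
  linarith

/-- Subadditivity replaces `u n` by a fixed `u N` at a cost controlled by the energy of `u n - u N`.
For the fixed density, dominated convergence applies. -/
theorem weighted_tendsto {u : ℕ → A} (hu : QCauchy E u) {θ : ℕ → X → ℝ}
    (hθ : ∀ n, Measurable (θ n)) {K : ℝ} (hK : 0 ≤ K) (h0 : ∀ n x, 0 ≤ θ n x)
    (hθK : ∀ n x, θ n x ≤ K) (hlim : ∀ᵐ x ∂m, Tendsto (fun n => θ n x) atTop (𝓝 0)) :
    Tendsto (fun n => ∫ x, θ n x * (Γ (u n) (u n)).rnDeriv m x ∂m) atTop (𝓝 0) := by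
  have hac := hm.absolutelyContinuous
  have hΓ := hD.isLocalForm
  have hnn : ∀ n (f : A), 0 ≤ ∫ x, θ n x * (Γ f f).rnDeriv m x ∂m := by
    intro n f
    refine integral_nonneg_of_ae ?_
    filter_upwards [hΓ.rnDeriv_nonneg hac f.2] with x hx
    exact mul_nonneg (h0 n x) hx
  have hfix : ∀ f : A,
      Tendsto (fun n => ∫ x, θ n x * (Γ f f).rnDeriv m x ∂m) atTop (𝓝 0) := by
    intro f
    have hz : (0 : ℝ) = ∫ x, 0 * (Γ f f).rnDeriv m x ∂m := by simp
    rw [hz]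
    refine tendsto_integral_of_dominated_convergence (fun x => K * ‖(Γ f f).rnDeriv m x‖)
      (fun n => (integrable_weight (hθ n) (K := K) (fun x => ?_) _).aestronglyMeasurable)
      ((SignedMeasure.integrable_rnDeriv _ _).norm.const_mul K) (fun n => ae_of_all _ fun x => ?_) ?_
    · rw [abs_of_nonneg (h0 n x)]; exact hθK n x
    · rw [norm_mul, Real.norm_of_nonneg (h0 n x)]
      exact mul_le_mul_of_nonneg_right (hθK n x) (norm_nonneg _)
    · filter_upwards [hlim] with x hx
      exact hx.mul_const _
  rw [Metric.tendsto_atTop]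
  intro ε hε
  obtain ⟨N, hN⟩ := hu (ε / (4 * (K + 1))) (by positivity)
  obtain ⟨M, hM⟩ := eventually_atTop.1
    ((hfix (u N)).eventually_lt_const (show 0 < ε / 4 by positivity))
  refine ⟨max N M, fun n hn => ?_⟩
  rw [Real.dist_eq, sub_zero, abs_of_nonneg (hnn _ _)]
  have h1 := hD.weighted_le hm (hθ n) (h0 n) (hθK n) (u n) (u N)
  have h2 := hN n (le_trans (le_max_left _ _) hn) N le_rfl
  have h3 := hM n (le_trans (le_max_right _ _) hn)
  rw [lt_div_iff₀ (by positivity)] at h2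
  have h4 : 0 ≤ E (u n - u N) (u n - u N) :=
    (hD.integral_rnDeriv_nonneg hm _).trans (hD.local_le hm _)
  nlinarith

/-- If the local energies weighted by a nowhere vanishing `χ ^ 2` tend to zero along a Cauchy
sequence, then so do the local energies. -/
theorem local_tendsto_of_weighted {v : ℕ → A} (hv : QCauchy E v) {χ : X → ℝ} (hχ : Measurable χ)
    {K : ℝ} (hχK : ∀ x, |χ x| ≤ K) (hχ0 : ∀ x, χ x ≠ 0)
    (hlim : Tendsto (fun n => ∫ x, χ x ^ 2 * (Γ (v n) (v n)).rnDeriv m x ∂m) atTop (𝓝 0)) :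
    Tendsto (fun n => ∫ x, (Γ (v n) (v n)).rnDeriv m x ∂m) atTop (𝓝 0) := by
  have hac := hm.absolutelyContinuous
  have hΓ := hD.isLocalForm
  have hχ2 : ∀ x, |χ x ^ 2| ≤ K ^ 2 := fun x => by
    rw [abs_pow]; exact pow_le_pow_left₀ (abs_nonneg _) (hχK x) 2
  rw [Metric.tendsto_atTop]
  intro ε hε
  obtain ⟨N, hN⟩ := hv (ε / 4) (by positivity)
  refine ⟨N, fun n hn => ?_⟩
  rw [Real.dist_eq, sub_zero, abs_of_nonneg (hD.integral_rnDeriv_nonneg hm _)]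
  -- These weights are at most `(k + 1) χ²`, so the hypothesis controls them for fixed `k`. They are
  -- at most one and tend to one everywhere because `χ` has no zero.
  set θ : ℕ → X → ℝ := fun k x => χ x ^ 2 / (χ x ^ 2 + 1 / (k + 1 : ℝ)) with hθ
  have hθm : ∀ k, Measurable (θ k) := fun k =>
    (hχ.pow_const 2).div ((hχ.pow_const 2).add_const _)
  have hθ0 : ∀ k x, 0 ≤ θ k x := fun k x => by positivity
  have hθ1 : ∀ k x, θ k x ≤ 1 := fun k x => by
    have : (0 : ℝ) < 1 / (k + 1 : ℝ) := by positivity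
    exact div_le_one_of_le₀ (by linarith) (by positivity)
  have hθχ : ∀ k x, θ k x ≤ (k + 1) * χ x ^ 2 := fun k x => by
    have h2 := sq_nonneg (χ x)
    simp only [hθ]
    rw [div_le_iff₀ (by positivity)]
    have h3 : (k + 1 : ℝ) * χ x ^ 2 * (χ x ^ 2 + 1 / (k + 1 : ℝ)) =
      χ x ^ 2 + (k + 1) * (χ x ^ 2 * χ x ^ 2) := by field_simp; ring
    rw [h3]
    have : 0 ≤ (k + 1 : ℝ) * (χ x ^ 2 * χ x ^ 2) := by positivity
    linarith
  have habs : ∀ k x, |θ k x| ≤ 1 := fun k x => by rw [abs_of_nonneg (hθ0 k x)]; exact hθ1 k x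
  -- Compare `v n` with `v j` for the weight `θ k` and let `j → ∞`: the weighted energy of `v j`
  -- vanishes, and what remains, `2 E(v n - v j) < ε / 2`, does not depend on `k`.
  have hk : ∀ k, ∫ x, θ k x * (Γ (v n) (v n)).rnDeriv m x ∂m ≤ ε / 2 := by
    intro k
    have hlim' := (hlim.const_mul (2 * (k + 1 : ℝ))).const_add (ε / 2)
    rw [mul_zero, add_zero] at hlim'
    refine ge_of_tendsto hlim' ?_
    filter_upwards [eventually_ge_atTop N] with j hj
    have h1 := hD.weighted_le hm (hθm k) (hθ0 k) (hθ1 k) (v n) (v j)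
    have h2 := hN n hn j hj
    have h3 : ∫ x, θ k x * (Γ (v j) (v j)).rnDeriv m x ∂m ≤
        ∫ x, (k + 1 : ℝ) * (χ x ^ 2 * (Γ (v j) (v j)).rnDeriv m x) ∂m := by
      refine integral_mono_ae (integrable_weight (hθm k) (habs k) _)
        ((integrable_weight (hχ.pow_const 2) hχ2 _).const_mul _) ?_
      filter_upwards [hΓ.rnDeriv_nonneg hac (v j).2] with x hx
      rw [← mul_assoc]
      exact mul_le_mul_of_nonneg_right (hθχ k x) hx
    rw [integral_const_mul] at h3
    linarith
  have hconv : Tendsto (fun k => ∫ x, θ k x * (Γ (v n) (v n)).rnDeriv m x ∂m) atTop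
      (𝓝 (∫ x, (Γ (v n) (v n)).rnDeriv m x ∂m)) := by
    refine tendsto_integral_of_dominated_convergence (fun x => ‖(Γ (v n) (v n)).rnDeriv m x‖)
      (fun k => (integrable_weight (hθm k) (habs k) _).aestronglyMeasurable)
      (SignedMeasure.integrable_rnDeriv _ _).norm (fun k => ae_of_all _ fun x => ?_)
      (ae_of_all _ fun x => ?_)
    · rw [norm_mul]
      exact mul_le_of_le_one_left (norm_nonneg _) (habs k x)
    · have h1 : Tendsto (fun k => θ k x) atTop (𝓝 (χ x ^ 2 / (χ x ^ 2 + 0))) :=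
        tendsto_const_nhds.div
          (tendsto_one_div_add_atTop_nhds_zero_nat.const_add (χ x ^ 2))
          (by rw [add_zero]; exact pow_ne_zero 2 (hχ0 x))
      rw [add_zero, div_self (pow_ne_zero 2 (hχ0 x))] at h1
      simpa using h1.mul_const ((Γ (v n) (v n)).rnDeriv m x)
  exact (le_of_tendsto' hconv hk).trans_lt (by linarith)

/-- The energy of a product. -/
theorem mul_energy_le {χ : X → ℝ} (hχ : χ ∈ A) {K : ℝ} (hχK : ∀ x, |χ x| ≤ K) (f : A) {s : ℝ}
    (hs : ∀ x, |(f : X → ℝ) x| ≤ s) :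
    E ⟨χ * f, hD.isLocalForm.mul_mem χ hχ f f.2⟩ ⟨χ * f, hD.isLocalForm.mul_mem χ hχ f f.2⟩ ≤
      2 * K ^ 2 * E f f + 2 * s ^ 2 * E ⟨χ, hχ⟩ ⟨χ, hχ⟩ := by
  have hac := hm.absolutelyContinuous
  have hΓ := hD.isLocalForm
  have hχ2 : ∀ x, χ x ^ 2 ≤ K ^ 2 := fun x => by
    rw [← sq_abs]; exact pow_le_pow_left₀ (abs_nonneg _) (hχK x) 2
  have hf2 : ∀ x, (f : X → ℝ) x ^ 2 ≤ s ^ 2 := fun x => by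
    rw [← sq_abs]; exact pow_le_pow_left₀ (abs_nonneg _) (hs x) 2
  have hχf := hΓ.mul_mem χ hχ f f.2
  rw [hD.apply_self hm, hD.apply_self hm f, hD.apply_self hm ⟨χ, hχ⟩]
  simp only
  have h1 : ∫ x, (Γ (χ * f) (χ * f)).rnDeriv m x ∂m ≤
      2 * K ^ 2 * ∫ x, (Γ f f).rnDeriv m x ∂m + 2 * s ^ 2 * ∫ x, (Γ χ χ).rnDeriv m x ∂m := by
    have hi := fun t : SignedMeasure X => SignedMeasure.integrable_rnDeriv t m
    rw [← integral_const_mul, ← integral_const_mul,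
      ← integral_add ((hi _).const_mul _) ((hi _).const_mul _)]
    refine integral_mono_ae (hi _) (((hi _).const_mul _).add ((hi _).const_mul _)) ?_
    filter_upwards [hΓ.rnDeriv_mul_le hac hχ f.2, hΓ.rnDeriv_nonneg hac hχ,
      hΓ.rnDeriv_nonneg hac f.2] with x h1 h2 h3
    have h4 := mul_le_mul_of_nonneg_right (hχ2 x) h3
    have h5 := mul_le_mul_of_nonneg_right (hf2 x) h2
    linarith [h1.1]
  have h2 : ∫ z, ((χ * f) (a z) - (χ * f) (b z)) ^ 2 ∂J ≤
      2 * K ^ 2 * ∫ z, ((f : X → ℝ) (a z) - (f : X → ℝ) (b z)) ^ 2 ∂J +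
        2 * s ^ 2 * ∫ z, (χ (a z) - χ (b z)) ^ 2 ∂J := by
    have hi1 := hD.jump_sq_integrable f.2
    have hi2 := hD.jump_sq_integrable hχ
    rw [← integral_const_mul, ← integral_const_mul,
      ← integral_add (hi1.const_mul _) (hi2.const_mul _)]
    refine integral_mono (hD.jump_sq_integrable hχf) ((hi1.const_mul _).add (hi2.const_mul _)) ?_
    intro z
    simp only [Pi.mul_apply]
    have h4 := mul_le_mul_of_nonneg_right (hχ2 (a z))
      (sq_nonneg ((f : X → ℝ) (a z) - (f : X → ℝ) (b z)))
    have h5 := mul_le_mul_of_nonneg_right (hf2 (b z)) (sq_nonneg (χ (a z) - χ (b z)))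
    have h6 := add_sq_le (a := χ (a z) * ((f : X → ℝ) (a z) - (f : X → ℝ) (b z)))
      (b := (f : X → ℝ) (b z) * (χ (a z) - χ (b z)))
    have h7 : χ (a z) * (f : X → ℝ) (a z) - χ (b z) * (f : X → ℝ) (b z) =
      χ (a z) * ((f : X → ℝ) (a z) - (f : X → ℝ) (b z)) +
        (f : X → ℝ) (b z) * (χ (a z) - χ (b z)) := by ring
    rw [h7]
    rw [mul_pow, mul_pow] at h6
    linarith
  have h3 : ∫ x, (χ * f) x ^ 2 ∂κ ≤
      2 * K ^ 2 * ∫ x, (f : X → ℝ) x ^ 2 ∂κ + 2 * s ^ 2 * ∫ x, χ x ^ 2 ∂κ := by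
    have hi1 := hD.kill_sq_integrable f.2
    have hi2 := hD.kill_sq_integrable hχ
    rw [← integral_const_mul, ← integral_const_mul,
      ← integral_add (hi1.const_mul _) (hi2.const_mul _)]
    refine integral_mono (hD.kill_sq_integrable hχf) ((hi1.const_mul _).add (hi2.const_mul _)) ?_
    intro x
    simp only [Pi.mul_apply, mul_pow]
    have h4 := mul_le_mul_of_nonneg_right (hχ2 x) (sq_nonneg ((f : X → ℝ) x))
    have h5 : 0 ≤ s ^ 2 * χ x ^ 2 := by positivity
    have h6 : 0 ≤ K ^ 2 * (f : X → ℝ) x ^ 2 := by positivity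
    linarith
  linarith

end

end IsDecomposition

theorem QCauchy.of_tendsto_zero {V : Type*} [AddCommGroup V] [Module ℝ V]
    {Q : V →ₗ[ℝ] V →ₗ[ℝ] ℝ} (hQ : IsPosForm Q) {d : ℕ → V}
    (hd : Tendsto (fun n => Q (d n) (d n)) atTop (𝓝 0)) : QCauchy Q d := by
  intro ε hε
  obtain ⟨N, hN⟩ := eventually_atTop.1 (hd.eventually_lt_const (show 0 < ε / 4 by positivity))
  refine ⟨N, fun i hi j hj => ?_⟩
  linarith [hQ.sub_le (d i) (d j), hN i hi, hN j hj]

namespace IsDecomposition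

variable {X Z : Type*} {mX : MeasurableSpace X} {mZ : MeasurableSpace Z}
  {A : Submodule ℝ (X → ℝ)} {E : A →ₗ[ℝ] A →ₗ[ℝ] ℝ} {Γ : (X → ℝ) → (X → ℝ) → SignedMeasure X}
  {J : Measure Z} {a b : Z → X} {κ m : Measure X} [IsFiniteMeasure m]

/-- Multiplication by a fixed function preserves Cauchy sequences that tend to zero uniformly. -/
theorem qCauchy_mul (hD : IsDecomposition A E Γ J a b κ) (hm : IsDominatedBy A Γ J a b κ m)
    (hE : IsPosForm E) {χ : X → ℝ} (hχ : χ ∈ A) {v : ℕ → A} (hv : QCauchy E v)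
    (hvs : ∀ n x, |(v n : X → ℝ) x| ≤ 1 / (n + 1 : ℝ)) :
    QCauchy E fun n => ⟨χ * v n, hD.isLocalForm.mul_mem χ hχ (v n) (v n).2⟩ := by
  obtain ⟨K, hK⟩ := hD.isLocalForm.bdd χ hχ
  intro ε hε
  obtain ⟨N, hN⟩ := hv (ε / (2 * (2 * K ^ 2 + 1))) (by positivity)
  -- This is the second term of `mul_energy_le` for `v i - v j`, whose absolute value is at most `2
  -- / (n + 1)` when `i, j ≥ n`.
  have hlim : Tendsto (fun n : ℕ => 2 * (2 * (1 / (n + 1 : ℝ))) ^ 2 * E ⟨χ, hχ⟩ ⟨χ, hχ⟩)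
      atTop (𝓝 0) := by
    have := ((((tendsto_one_div_add_atTop_nhds_zero_nat (𝕜 := ℝ)).const_mul 2).pow 2).const_mul
      2).mul_const (E ⟨χ, hχ⟩ ⟨χ, hχ⟩)
    simpa only [mul_zero, zero_mul, ne_eq, OfNat.ofNat_ne_zero, not_false_eq_true, zero_pow]
      using this
  obtain ⟨M, hM⟩ := eventually_atTop.1 (hlim.eventually_lt_const (show 0 < ε / 2 by positivity))
  refine ⟨max N M, fun i hi j hj => ?_⟩
  have hs : ∀ x, |((v i - v j : A) : X → ℝ) x| ≤ 2 * (1 / ((max N M : ℕ) + 1 : ℝ)) := by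
    intro x
    have h1 : 1 / (i + 1 : ℝ) ≤ 1 / ((max N M : ℕ) + 1 : ℝ) :=
      one_div_le_one_div_of_le (by positivity) (by exact_mod_cast Nat.succ_le_succ hi)
    have h2 : 1 / (j + 1 : ℝ) ≤ 1 / ((max N M : ℕ) + 1 : ℝ) :=
      one_div_le_one_div_of_le (by positivity) (by exact_mod_cast Nat.succ_le_succ hj)
    have h3 := abs_sub ((v i : X → ℝ) x) ((v j : X → ℝ) x)
    rw [Submodule.coe_sub, Pi.sub_apply]
    linarith [hvs i x, hvs j x]
  have h1 := hD.mul_energy_le hm hχ hK (v i - v j) hs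
  have h2 := hN i (le_trans (le_max_left _ _) hi) j (le_trans (le_max_left _ _) hj)
  have h3 := hM _ (le_max_right N M)
  have h4 : (⟨χ * v i, hD.isLocalForm.mul_mem χ hχ (v i) (v i).2⟩ : A) -
      ⟨χ * v j, hD.isLocalForm.mul_mem χ hχ (v j) (v j).2⟩ = ⟨χ * (v i - v j : A),
        hD.isLocalForm.mul_mem χ hχ _ (v i - v j).2⟩ := by
    apply Subtype.ext
    simp [mul_sub]
  rw [h4]
  rw [lt_div_iff₀ (by positivity)] at h2
  have h5 := hE.nonneg (v i - v j)
  nlinarith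

open Polynomial in
/-- A Cauchy sequence that tends to zero almost everywhere can be replaced, after passing to a
subsequence, by one that tends to zero uniformly. -/
theorem exists_uniform (hD : IsDecomposition A E Γ J a b κ) (hm : IsDominatedBy A Γ J a b κ m)
    {u : ℕ → A} (hu : QCauchy E u)
    (hlim : ∀ᵐ x ∂m, Tendsto (fun n => (u n : X → ℝ) x) atTop (𝓝 0)) :
    ∃ (ns : ℕ → ℕ) (v : ℕ → A), Tendsto ns atTop atTop ∧
      (∀ n x, |(v n : X → ℝ) x| ≤ 1 / (n + 1 : ℝ)) ∧
      Tendsto (fun n => E (v n - u (ns n)) (v n - u (ns n))) atTop (𝓝 0) := by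
  have hΓ := hD.isLocalForm
  have hac := hm.absolutelyContinuous
  have hex := fun j : ℕ => exists_small_polynomial (ε := 1 / (j + 1 : ℝ)) (by positivity)
  -- The constant `C j` is chosen before the interval. The bounds `M n` of the functions `u n` may
  -- grow with `n`, and the estimate `|p' - 1| ≤ C j (u n)²` must survive this.
  choose C q hq using hex
  choose M hM using fun n => hΓ.bdd (u n) (u n).2
  have hv := fun j n => (hΓ.rnDeriv_polynomial hac (u n).2 (u n).2 (q j (M n))).1
  have hder : ∀ p : ℝ[X], ∀ t : ℝ, (derivative (Polynomial.X * (p - 1))).eval t =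
      (derivative (Polynomial.X * p)).eval t - 1 := by
    intro p t
    simp [mul_sub]
  -- The difference `p(u n) - u n` is again a polynomial in `u n` without constant term, so the
  -- chain rule gives its local energy as `(p'(u n) - 1)² Γ(u n)`.
  have hsub : ∀ j n, ((⟨_, hv j n⟩ - u n : A) : X → ℝ) =
      fun x => (Polynomial.X * (q j (M n) - 1)).eval ((u n : X → ℝ) x) := by
    intro j n
    ext x
    simp [mul_sub]
  have hθ3 : ∀ j n t, |t| ≤ M n →
      |(derivative (Polynomial.X * (q j (M n) - 1))).eval t| ≤ 3 := by
    intro j n t ht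
    rw [hder]
    have := (hq j (M n) t ht).2.2.1
    rw [abs_le] at this ⊢
    constructor <;> linarith [this.1, this.2]
  have hloc : ∀ j, Tendsto (fun n => ∫ x, (Γ (⟨_, hv j n⟩ - u n : A)
      (⟨_, hv j n⟩ - u n : A)).rnDeriv m x ∂m) atTop (𝓝 0) := by
    intro j
    have := hD.weighted_tendsto hm hu
      (θ := fun n x => (derivative (Polynomial.X * (q j (M n) - 1))).eval ((u n : X → ℝ) x) ^ 2)
      (fun n => (((derivative (Polynomial.X * (q j (M n) - 1))).continuous.measurable).comp
        (hΓ.measurable _ (u n).2)).pow_const 2) (K := 9) (by norm_num)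
      (fun n x => sq_nonneg _) (fun n x => ?_) ?_
    · refine this.congr fun n => ?_
      rw [hsub]
      exact integral_congr_ae (hΓ.rnDeriv_polynomial_self hac (u n).2 _).symm
    · rw [← sq_abs]
      have := pow_le_pow_left₀ (abs_nonneg _) (hθ3 j n _ (hM n x)) 2
      linarith
    · filter_upwards [hlim] with x hx
      have h0 : Tendsto (fun n => (C j * (u n : X → ℝ) x ^ 2) ^ 2) atTop (𝓝 0) := by
        simpa using ((hx.pow 2).const_mul (C j)).pow 2
      refine squeeze_zero (fun n => sq_nonneg _) (fun n => ?_) h0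
      rw [hder, ← sq_abs]
      exact pow_le_pow_left₀ (abs_nonneg _) (hq j (M n) _ (hM n x)).2.2.2 2
  -- Diagonal selection: for the `j`-th smallness level, go far enough along the sequence to make
  -- the local error less than `1 / (j + 1)`.
  have hsel : ∀ j : ℕ, ∃ n ≥ j, ∫ x, (Γ (⟨_, hv j n⟩ - u n : A)
      (⟨_, hv j n⟩ - u n : A)).rnDeriv m x ∂m < 1 / (j + 1 : ℝ) := by
    intro j
    have hpos : (0 : ℝ) < 1 / (j + 1 : ℝ) := by positivity
    exact (((eventually_ge_atTop j).and ((hloc j).eventually_lt_const hpos)).exists).imp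
      fun n h => ⟨h.1, h.2⟩
  choose ns hns hnsl using hsel
  have hnst : Tendsto ns atTop atTop := tendsto_atTop_mono hns tendsto_id
  refine ⟨ns, fun j => ⟨_, hv j (ns j)⟩, hnst,
    fun j x => (hq j (M (ns j)) _ (hM (ns j) x)).1, ?_⟩
  obtain ⟨hj, hk⟩ := hD.jump_kill_tendsto hm hu hlim
  -- The factor `9` is the square of the Lipschitz constant `3` of `p - id`; the factor `4` comes
  -- from `|p t - t| ≤ 2 |t|`.
  have hbound := ((tendsto_one_div_add_atTop_nhds_zero_nat (𝕜 := ℝ)).add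
    ((hj.comp hnst).const_mul 9)).add ((hk.comp hnst).const_mul 4)
  simp only [mul_zero, add_zero] at hbound
  have hEeq := fun j => hD.apply_self hm (⟨_, hv j (ns j)⟩ - u (ns j))
  refine squeeze_zero (fun j => ?_) (fun j => ?_) hbound
  · exact (hD.integral_rnDeriv_nonneg hm _).trans (hD.local_le hm _)
  · rw [hEeq]
    refine add_le_add (add_le_add (hnsl j).le ?_) ?_
    · rw [Function.comp_apply, ← integral_const_mul]
      refine integral_mono (hD.jump_sq_integrable (Subtype.prop _))
        ((hD.jump_sq_integrable (u (ns j)).2).const_mul 9) fun z => ?_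
      simp only [hsub]
      have := abs_eval_sub_le_of_derivative (hθ3 j (ns j)) (hM (ns j) (a z)) (hM (ns j) (b z))
      have := pow_le_pow_left₀ (abs_nonneg _) this 2
      rw [sq_abs, mul_pow, sq_abs] at this
      linarith
    · rw [Function.comp_apply, ← integral_const_mul]
      refine integral_mono (hD.kill_sq_integrable (Subtype.prop _))
        ((hD.kill_sq_integrable (u (ns j)).2).const_mul 4) fun x => ?_
      have h1 := (hq j (M (ns j)) _ (hM (ns j) x)).2.1
      simp only [Submodule.coe_sub, Pi.sub_apply]
      have h2 := abs_sub ((Polynomial.X * q j (M (ns j))).eval ((u (ns j) : X → ℝ) x))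
        ((u (ns j) : X → ℝ) x)
      have h3 := pow_le_pow_left₀ (abs_nonneg _) (h2.trans (add_le_add h1 le_rfl)) 2
      rw [sq_abs] at h3
      have h4 := sq_abs ((u (ns j) : X → ℝ) x)
      nlinarith

/-- The hypothesis `hcl` is the only link to the original `L²` space: it expresses closability along
sequences tending to zero uniformly relative to `χ`. The uniform replacement `v` of `u`, multiplied
by `χ`, is such a sequence. -/
theorem tendsto_energy_zero (hD : IsDecomposition A E Γ J a b κ)
    (hm : IsDominatedBy A Γ J a b κ m) (hE : IsPosForm E) {χ : X → ℝ} (hχ : χ ∈ A)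
    (hχ0 : ∀ x, χ x ≠ 0)
    (hcl : ∀ w : ℕ → A, QCauchy E w → (∀ n x, |(w n : X → ℝ) x| ≤ 1 / (n + 1 : ℝ) * |χ x|) →
      Tendsto (fun n => E (w n) (w n)) atTop (𝓝 0))
    {u : ℕ → A} (hu : QCauchy E u)
    (hlim : ∀ᵐ x ∂m, Tendsto (fun n => (u n : X → ℝ) x) atTop (𝓝 0)) :
    Tendsto (fun n => E (u n) (u n)) atTop (𝓝 0) := by
  have hΓ := hD.isLocalForm
  have hac := hm.absolutelyContinuous
  obtain ⟨K, hK⟩ := hΓ.bdd χ hχ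
  obtain ⟨ns, v, hns, hvs, hvu⟩ := hD.exists_uniform hm hu hlim
  have hv : QCauchy E v := by
    have := (QCauchy.of_tendsto_zero hE hvu).add hE (hu.comp hns)
    convert this using 1
    ext1 n
    simp
  have hw := hcl _ (hD.qCauchy_mul hm hE hχ hv hvs) (fun n x => by
    change |χ x * (v n : X → ℝ) x| ≤ _
    rw [abs_mul, mul_comm]
    exact mul_le_mul_of_nonneg_right (hvs n x) (abs_nonneg _))
  have hone := tendsto_one_div_add_atTop_nhds_zero_nat (𝕜 := ℝ)
  have hχ2 : ∀ x, |χ x ^ 2| ≤ K ^ 2 := fun x => by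
    rw [abs_pow]; exact pow_le_pow_left₀ (abs_nonneg _) (hK x) 2
  -- Leibniz: `χ² Γ(v) ≤ 2 Γ(χ v) + 2 v² Γ(χ)`. The first term is bounded by `2 E(χ v)`, the second
  -- by the uniform smallness of `v`.
  have hweight : Tendsto (fun n => ∫ x, χ x ^ 2 * (Γ (v n) (v n)).rnDeriv m x ∂m) atTop (𝓝 0) := by
    have hb := (hw.const_mul 2).add (((hone.pow 2).mul_const (E ⟨χ, hχ⟩ ⟨χ, hχ⟩)).const_mul 2)
    simp only [ne_eq, OfNat.ofNat_ne_zero, not_false_eq_true, zero_pow, zero_mul, mul_zero,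
      add_zero] at hb
    refine squeeze_zero (fun n => ?_) (fun n => ?_) hb
    · refine integral_nonneg_of_ae ?_
      filter_upwards [hΓ.rnDeriv_nonneg hac (v n).2] with x hx
      exact mul_nonneg (sq_nonneg _) hx
    · have hi := fun t : SignedMeasure X => SignedMeasure.integrable_rnDeriv t m
      have h1 : ∫ x, χ x ^ 2 * (Γ (v n) (v n)).rnDeriv m x ∂m ≤
          ∫ x, (2 * (Γ (χ * v n) (χ * v n)).rnDeriv m x +
            2 * ((1 / (n + 1 : ℝ)) ^ 2 * (Γ χ χ).rnDeriv m x)) ∂m := by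
        refine integral_mono_ae (integrable_weight ((hΓ.measurable χ hχ).pow_const 2) hχ2 _)
          (((hi _).const_mul _).add (((hi _).const_mul _).const_mul _)) ?_
        filter_upwards [hΓ.rnDeriv_mul_le hac hχ (v n).2, hΓ.rnDeriv_nonneg hac hχ] with x h1 h2
        have h3 := pow_le_pow_left₀ (abs_nonneg _) (hvs n x) 2
        rw [sq_abs] at h3
        have h4 := mul_le_mul_of_nonneg_right h3 h2
        linarith [h1.2]
      rw [integral_add ((hi _).const_mul _) (((hi _).const_mul _).const_mul _),
        integral_const_mul, integral_const_mul, integral_const_mul] at h1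
      have h2 := hD.local_le hm ⟨χ * v n, hΓ.mul_mem χ hχ (v n) (v n).2⟩
      have h3 := mul_le_mul_of_nonneg_left (hD.local_le hm ⟨χ, hχ⟩)
        (sq_nonneg (1 / (n + 1 : ℝ)))
      linarith
  have hvloc := hD.local_tendsto_of_weighted hm hv (hΓ.measurable χ hχ) hK hχ0 hweight
  obtain ⟨hj, hk⟩ := hD.jump_kill_tendsto hm hu hlim
  refine hu.tendsto_zero_of_subseq hE hns ?_
  -- The local energy of `u` is at most `2 E(v - u)` plus twice the local energy of `v`; the jump
  -- and killing energies of `u` enter directly.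
  have hb := (((hvu.const_mul 2).add (hvloc.const_mul 2)).add (hj.comp hns)).add (hk.comp hns)
  simp only [mul_zero, add_zero] at hb
  refine squeeze_zero (fun n => hE.nonneg _) (fun n => ?_) hb
  have h1 := hD.weighted_le hm (θ := fun _ => 1) measurable_const (K := 1) (fun _ => zero_le_one)
    (fun _ => le_rfl) (u (ns n)) (v n)
  rw [IsPosForm.sub_comm] at h1
  simp only [one_mul, mul_one] at h1
  rw [hD.apply_self hm (u (ns n))]
  simp only [Function.comp_apply]
  linarith

end IsDecomposition

/-! ### Density of the algebra in `L²(m)` -/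

section Density

variable {X : Type*} {mX : MeasurableSpace X} {m : Measure X}

/-- Vitali's theorem: functions bounded by one are uniformly integrable on a finite measure space.
-/
theorem tendsto_toLp_of_bounded [IsFiniteMeasure m] {f : ℕ → X → ℝ} {g : X → ℝ}
    (hf : ∀ n, MemLp (f n) 2 m)
    (hg : MemLp g 2 m) (hf1 : ∀ n x, |f n x| ≤ 1)
    (hfg : ∀ x, Tendsto (fun n => f n x) atTop (𝓝 (g x))) :
    Tendsto (fun n => (hf n).toLp (f n)) atTop (𝓝 (hg.toLp g)) := by
  rw [Lp.tendsto_Lp_iff_tendsto_eLpNorm'']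
  refine tendsto_Lp_finite_of_tendsto_ae (by norm_num) (by norm_num) (fun n => (hf n).1) hg
    (fun ε hε => ?_) (ae_of_all _ hfg)
  obtain ⟨δ, hδ, h⟩ := unifIntegrable_const (ι := ℕ) (p := 2) (by norm_num) (by norm_num)
    (memLp_const (1 : ℝ) : MemLp (fun _ : X => (1 : ℝ)) 2 m) hε
  refine ⟨δ, hδ, fun n s hs hsδ => (eLpNorm_mono fun x => ?_).trans (h n s hs hsδ)⟩
  by_cases hx : x ∈ s
  · simpa [hx] using hf1 n x
  · simp [hx]

/-- The map sending functions to their classes in `L²`. -/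
noncomputable def toL2 (A : Submodule ℝ (X → ℝ)) (hA : ∀ f ∈ A, MemLp f 2 m) :
    A →ₗ[ℝ] Lp ℝ 2 m where
  toFun f := (hA f f.2).toLp f
  map_add' _ _ := rfl
  map_smul' _ _ := rfl

theorem toL2_tendsto_iff {A : Submodule ℝ (X → ℝ)} {hA : ∀ f ∈ A, MemLp f 2 m} {u : ℕ → A}
    {v : Lp ℝ 2 m} : Tendsto (fun n => toL2 A hA (u n)) atTop (𝓝 v) ↔
      Tendsto (fun n => eLpNorm ((u n : X → ℝ) - (v : X → ℝ)) 2 m) atTop (𝓝 0) := by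
  rw [Lp.tendsto_Lp_iff_tendsto_eLpNorm']
  refine tendsto_congr fun n => eLpNorm_congr_ae ?_
  exact (MemLp.coeFn_toLp (hA _ (u n).2)).sub EventuallyEq.rfl

/-- An algebra of bounded functions that is stable under the unit contraction and has a nowhere
vanishing element is dense in `L²` of the generated σ-algebra. -/
theorem dense_range_toL2 [IsFiniteMeasure m] {A : Submodule ℝ (X → ℝ)} (hA : ∀ f ∈ A, MemLp f 2 m)
    (hgen : mX = ⨆ f ∈ A, MeasurableSpace.comap f inferInstance)
    (hmul : ∀ f ∈ A, ∀ g ∈ A, f * g ∈ A) (hbdd : ∀ f ∈ A, ∃ C, ∀ x, |f x| ≤ C)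
    (hcon : ∀ f ∈ A, ∀ c : ℝ, 0 ≤ c → (fun x => min (max (f x) 0) c) ∈ A)
    (hχ : ∃ χ ∈ A, ∀ x, χ x ≠ 0) :
    Dense (LinearMap.range (toL2 A hA) : Set (Lp ℝ 2 m)) := by
  have hmeas : ∀ f ∈ A, Measurable f := by
    intro f hf
    rw [measurable_iff_comap_le, hgen]
    exact le_iSup₂_of_le f hf le_rfl
  set S : Set (Set X) := {s | ∃ f ∈ A, (∀ x, 0 ≤ f x) ∧ s = {x | 0 < f x}} with hS
  have hpos : ∀ f ∈ A, (fun x => max (f x) 0) ∈ A := by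
    intro f hf
    obtain ⟨C, hC⟩ := hbdd f hf
    convert hcon f hf |C| (abs_nonneg C) using 2 with x
    exact (min_eq_left (max_le ((le_abs_self _).trans ((hC x).trans (le_abs_self C)))
      (abs_nonneg C))).symm
  have hIoi : ∀ (𝓢 : MeasurableSpace X) (g : X → ℝ),
      (∀ c, MeasurableSet[𝓢] (g ⁻¹' Set.Ioi c)) → Measurable[𝓢] g :=
    fun 𝓢 g h => measurable_of_Ioi h
  have hgenS : mX = MeasurableSpace.generateFrom S := by
    apply le_antisymm
    · have key : ∀ f ∈ A, Measurable[MeasurableSpace.generateFrom S] fun x => max (f x) 0 := by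
        intro f hf
        refine hIoi _ _ fun c => ?_
        rcases lt_or_ge c 0 with hc | hc
        · have : (fun x => max (f x) 0) ⁻¹' Set.Ioi c = Set.univ :=
            Set.eq_univ_of_forall fun x => hc.trans_le (le_max_right _ _)
          rw [this]
          exact MeasurableSet.univ
        -- For `c ≥ 0`, `{f⁺ > c}` is the positivity set of `f⁺ - (f⁺ ∧ c)`, a nonnegative element
        -- of `A`.
        · refine MeasurableSpace.measurableSet_generateFrom
            ⟨_, A.sub_mem (hpos f hf) (hcon f hf c hc), fun x => ?_, ?_⟩
          · simp only [Pi.sub_apply, sub_nonneg]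
            exact min_le_left _ _
          · ext x
            simp only [Set.mem_preimage, Set.mem_Ioi, Set.mem_ofPred_eq, Pi.sub_apply, sub_pos]
            exact ⟨fun h => min_lt_iff.2 (Or.inr h), fun h => (min_lt_iff.1 h).resolve_left (lt_irrefl _)⟩
      conv_lhs => rw [hgen]
      refine iSup₂_le fun f hf => ?_
      rw [← measurable_iff_comap_le]
      have h1 : f = fun x => max (f x) 0 - max ((-f) x) 0 := by
        ext x
        rcases le_total (f x) 0 with h | h
        · rw [max_eq_right h, Pi.neg_apply, max_eq_left (by linarith)]; ring
        · rw [max_eq_left h, Pi.neg_apply, max_eq_right (by linarith)]; ring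
      rw [h1]
      exact (key f hf).sub (key (-f) (A.neg_mem hf))
    · refine MeasurableSpace.generateFrom_le ?_
      rintro _ ⟨f, hf, -, rfl⟩
      exact measurableSet_lt measurable_const (hmeas f hf)
  have hpi : IsPiSystem S := by
    rintro _ ⟨f, hf, hf0, rfl⟩ _ ⟨g, hg, hg0, rfl⟩ -
    refine ⟨f * g, hmul f hf g hg, fun x => mul_nonneg (hf0 x) (hg0 x), ?_⟩
    ext x
    simp only [Set.mem_inter_iff, Set.mem_ofPred_eq, Pi.mul_apply]
    constructor
    · rintro ⟨h1, h2⟩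
      exact mul_pos h1 h2
    · intro h
      exact ⟨pos_of_mul_pos_left h (hg0 x), pos_of_mul_pos_right h (hf0 x)⟩
  set C := (LinearMap.range (toL2 A hA)).topologicalClosure with hC
  have hCcl : IsClosed (C : Set (Lp ℝ 2 m)) := Submodule.isClosed_topologicalClosure _
  have hind : ∀ s, MeasurableSet s → MemLp (s.indicator fun _ => (1 : ℝ)) 2 m :=
    fun s hs => (memLp_const 1).indicator hs
  have habs1 : ∀ (s : Set X) x, |s.indicator (fun _ => (1 : ℝ)) x| ≤ 1 := by
    intro s x
    by_cases hx : x ∈ s <;> simp [hx]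
  -- The functions `(n f) ∧ 1` belong to `A` and converge pointwise to the indicator of `{f > 0}`.
  have hbasic : ∀ f ∈ A, (∀ x, 0 ≤ f x) → ∀ h : MeasurableSet {x | 0 < f x},
      (hind _ h).toLp _ ∈ C := by
    intro f hf hf0 h
    have hfn : ∀ n : ℕ, (fun x => min (max (((n : ℝ) • f) x) 0) 1) ∈ A := fun n =>
      hcon _ (A.smul_mem n hf) 1 zero_le_one
    refine hCcl.mem_of_tendsto (tendsto_toLp_of_bounded (fun n => hA _ (hfn n)) (hind _ h)
      (fun n x => ?_) (fun x => ?_)) (Eventually.of_forall fun n =>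
        Submodule.le_topologicalClosure _ ⟨⟨_, hfn n⟩, rfl⟩)
    · rw [abs_of_nonneg (le_min (le_max_right _ _) zero_le_one)]
      exact min_le_right _ _
    · rcases (hf0 x).eq_or_lt with h0 | h0
      · simp [← h0]
      · have h1 : Tendsto (fun n : ℕ => (n : ℝ) * f x) atTop atTop :=
          tendsto_natCast_atTop_atTop.atTop_mul_const h0
        refine tendsto_const_nhds.congr' ?_
        filter_upwards [h1.eventually_ge_atTop 1] with n hn
        simp only [Pi.smul_apply, smul_eq_mul]
        rw [max_eq_left (by linarith), min_eq_right hn]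
        simp [h0]
  have huniv : (hind _ MeasurableSet.univ).toLp _ ∈ C := by
    obtain ⟨χ, hχA, hχ0⟩ := hχ
    have h1 : {x | 0 < (χ * χ) x} = Set.univ :=
      Set.eq_univ_of_forall fun x => mul_self_pos.2 (hχ0 x)
    have := hbasic (χ * χ) (hmul χ hχA χ hχA) (fun x => mul_self_nonneg _)
      (by rw [h1]; exact MeasurableSet.univ)
    convert this using 3
    rw [h1]
  have hall : ∀ s (hs : MeasurableSet s), (hind s hs).toLp _ ∈ C := by
    -- Dynkin's π-λ theorem. Complements use the indicator of the whole space, which is available as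
    -- `{χ² > 0}`; disjoint unions are limits of finite unions.
    refine MeasurableSpace.induction_on_inter hgenS hpi ?_ ?_ ?_ ?_
    · convert C.zero_mem
      rw [← MemLp.toLp_zero (MemLp.zero' : MemLp (fun _ : X => (0 : ℝ)) 2 m)]
      congr 1
      simp only [Set.indicator_empty]
      rfl
    · rintro _ ⟨f, hf, hf0, rfl⟩
      exact hbasic f hf hf0 (measurableSet_lt measurable_const (hmeas f hf))
    · intro t ht h
      have h1 : (hind _ ht.compl).toLp _ =
          (hind _ MeasurableSet.univ).toLp _ - (hind _ ht).toLp _ := by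
        rw [← MemLp.toLp_sub]
        congr 1
        ext x
        by_cases hx : x ∈ t <;> simp [hx]
      rw [h1]
      exact C.sub_mem huniv h
    · intro f hdisj hfm hf
      have hU : ∀ n, MeasurableSet (⋃ i ∈ Finset.range n, f i) := fun n =>
        Finset.measurableSet_biUnion _ fun i _ => hfm i
      have hmem : ∀ n, (hind _ (hU n)).toLp _ ∈ C := by
        intro n
        induction n with
        | zero =>
          convert C.zero_mem
          rw [← MemLp.toLp_zero (MemLp.zero' : MemLp (fun _ : X => (0 : ℝ)) 2 m)]
          congr 1
          simp only [Finset.range_zero, Finset.notMem_empty, Set.iUnion_of_empty, Set.iUnion_empty,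
            Set.indicator_empty]
          rfl
        | succ n ih =>
          have h1 : (hind _ (hU (n + 1))).toLp _ =
              (hind _ (hU n)).toLp _ + (hind _ (hfm n)).toLp _ := by
            rw [← MemLp.toLp_add]
            congr 1
            have h2 : (⋃ i ∈ Finset.range (n + 1), f i) = (⋃ i ∈ Finset.range n, f i) ∪ f n := by
              ext x
              simp only [Set.mem_iUnion, Finset.mem_range, Set.mem_union, Order.lt_add_one_iff,
                exists_prop]
              constructor
              · rintro ⟨i, hi, hx⟩
                rcases hi.lt_or_eq with h | rfl
                · exact Or.inl ⟨i, h, hx⟩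
                · exact Or.inr hx
              · rintro (⟨i, hi, hx⟩ | hx)
                · exact ⟨i, hi.le, hx⟩
                · exact ⟨n, le_rfl, hx⟩
            rw [h2, Set.indicator_union_of_disjoint]
            · rfl
            · rw [Set.disjoint_iUnion₂_left]
              exact fun i hi => hdisj (Finset.mem_range.1 hi).ne
          rw [h1]
          exact C.add_mem ih (hf n)
      refine hCcl.mem_of_tendsto (tendsto_toLp_of_bounded (fun n => hind _ (hU n))
        (hind _ (.iUnion hfm)) (fun n x => habs1 _ x) (fun x => ?_)) (Eventually.of_forall hmem)
      refine tendsto_const_nhds.congr' ?_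
      by_cases hx : x ∈ ⋃ i, f i
      · obtain ⟨i, hi⟩ := Set.mem_iUnion.1 hx
        filter_upwards [eventually_gt_atTop i] with n hn
        have : x ∈ ⋃ i ∈ Finset.range n, f i :=
          Set.mem_biUnion (Finset.mem_coe.2 (Finset.mem_range.2 hn)) hi
        rw [Set.indicator_of_mem hx, Set.indicator_of_mem this]
      · refine Eventually.of_forall fun n => ?_
        have : x ∉ ⋃ i ∈ Finset.range n, f i := by
          simp only [Set.mem_iUnion, not_exists] at hx ⊢
          exact fun i _ => hx i
        simp only [Set.indicator_of_notMem hx, Set.indicator_of_notMem this]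
  rw [Submodule.dense_iff_topologicalClosure_eq_top, ← hC, eq_top_iff]
  rintro f -
  refine Lp.induction (by norm_num) (fun f => f ∈ C) ?_ ?_ hCcl f
  · intro c s hs hms
    have h1 : ((Lp.simpleFunc.indicatorConst 2 hs hms.ne c : Lp.simpleFunc ℝ 2 m) : Lp ℝ 2 m) =
        c • (hind s hs).toLp _ := by
      rw [Lp.simpleFunc.coe_indicatorConst, indicatorConstLp, ← MemLp.toLp_const_smul]
      congr 1
      ext x
      by_cases hx : x ∈ s <;> simp [hx]
    rw [h1]
    exact C.smul_mem c (hall s hs)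
  · intro f g hf hg _ h1 h2
    exact C.add_mem h1 h2

end Density

/-! ### The Markov property of the closure and translation to functions -/

theorem abs_contraction_sub_le (s t : ℝ) :
    |min (max s 0) 1 - min (max t 0) 1| ≤ |s - t| :=
  (abs_min_sub_min_le_max _ _ _ _).trans (max_le ((abs_max_sub_max_le_max _ _ _ _).trans
    (by simp)) (by simp))

theorem tendsto_contraction {X : Type*} {mX : MeasurableSpace X} {m : Measure X}
    {A : Submodule ℝ (X → ℝ)} {hA : ∀ f ∈ A, MemLp f 2 m} {u g : ℕ → A} {v w : Lp ℝ 2 m}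
    (hg : ∀ n x, (g n : X → ℝ) x = min (max ((u n : X → ℝ) x) 0) 1)
    (hw : (w : X → ℝ) =ᵐ[m] fun x => min (max ((v : X → ℝ) x) 0) 1)
    (hu : Tendsto (fun n => toL2 A hA (u n)) atTop (𝓝 v)) :
    Tendsto (fun n => toL2 A hA (g n)) atTop (𝓝 w) := by
  rw [tendsto_iff_dist_tendsto_zero] at hu ⊢
  refine squeeze_zero (fun _ => dist_nonneg) (fun n => ?_) hu
  rw [dist_eq_norm, dist_eq_norm]
  apply Lp.norm_le_norm_of_ae_le
  have h1 : (toL2 A hA (g n) : X → ℝ) =ᵐ[m] (g n : X → ℝ) :=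
    MemLp.coeFn_toLp (hA _ (g n).2)
  have h2 : (toL2 A hA (u n) : X → ℝ) =ᵐ[m] (u n : X → ℝ) :=
    MemLp.coeFn_toLp (hA _ (u n).2)
  filter_upwards [h1, h2, hw, Lp.coeFn_sub (toL2 A hA (g n)) w,
    Lp.coeFn_sub (toL2 A hA (u n)) v] with x h1 h2 h3 h4 h5
  rw [h4, h5, Pi.sub_apply, Pi.sub_apply, h1, h2, h3, hg]
  exact abs_contraction_sub_le _ _

/-- The closure of a closable Markovian form on an algebra of functions is a Dirichlet form. -/
theorem exists_dirichletForm_closure {X : Type*} {mX : MeasurableSpace X} {m : Measure X}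
    {A : Submodule ℝ (X → ℝ)} {E : A →ₗ[ℝ] A →ₗ[ℝ] ℝ} (hE : IsPosForm E)
    (hA : ∀ f ∈ A, MemLp f 2 m)
    (hdense : Dense (LinearMap.range (toL2 A hA) : Set (Lp ℝ 2 m)))
    (hcon : ∀ f : A, ∃ g : A, (∀ x, (g : X → ℝ) x = min (max ((f : X → ℝ) x) 0) 1) ∧
      E g g ≤ E f f)
    (hcl : QClosable E (toL2 A hA)) :
    ∃ D : DirichletForm m, (∀ v, v ∈ D.domain ↔ ∃ u, QApprox E (toL2 A hA) u v) ∧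
      ∀ (v w : D.domain) (f g : ℕ → A), QApprox E (toL2 A hA) f v →
        QApprox E (toL2 A hA) g w → Tendsto (fun n => E (f n) (g n)) atTop (𝓝 (D.form v w)) := by
  obtain ⟨F, hF⟩ := exists_closureForm hE hcl
  have hpos := closureForm_isPosForm hF
  refine ⟨{ domain := closureDomain hE (toL2 A hA), form := F, dense := ?_, symm := hpos.symm,
            nonneg := hpos.nonneg, closed := closureForm_closed hF, markov := ?_ },
    fun v => Iff.rfl, hF⟩
  · refine hdense.mono ?_
    rintro _ ⟨f, rfl⟩
    exact ⟨_, QApprox.const E _ f⟩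
  · intro v
    obtain ⟨u, hu⟩ := v.2
    choose g hg hgE using fun n => hcon (u n)
    have hmem : MemLp (fun x => min (max (((v : Lp ℝ 2 m) : X → ℝ) x) 0) 1) 2 m := by
      refine (Lp.memLp (v : Lp ℝ 2 m)).mono ?_ (ae_of_all _ fun x => ?_)
      · exact ((Lp.aestronglyMeasurable _).sup aestronglyMeasurable_const).inf
          aestronglyMeasurable_const
      · rw [Real.norm_eq_abs, Real.norm_eq_abs]
        simpa using abs_contraction_sub_le (((v : Lp ℝ 2 m) : X → ℝ) x) 0
    have hw := hmem.coeFn_toLp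
    -- The truncations `g n` converge in `L²` with energies bounded by those of `u n`, but need not
    -- be Cauchy for the form. Convex combinations are, and their energies are eventually at most
    -- the energy of `v` plus `ε`.
    obtain ⟨y, hy, hyw, hyE⟩ := exists_qCauchy_tendsto hE (toL2 A hA) g hgE (hF v v u u hu hu)
      (tendsto_contraction hg hw hu.2)
    refine ⟨⟨hmem.toLp _, y, hy, hyw⟩, hw, ?_⟩
    refine le_of_forall_pos_le_add fun ε hε => ?_
    exact le_of_tendsto (hF ⟨hmem.toLp _, y, hy, hyw⟩ ⟨hmem.toLp _, y, hy, hyw⟩ y y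
      ⟨hy, hyw⟩ ⟨hy, hyw⟩) (hyE ε hε)

/-- A form on functions that is given by a closable form on a subspace is closable. -/
theorem isClosableIn_of_qClosable {X : Type*} {mX : MeasurableSpace X} {m : Measure X}
    {A : Submodule ℝ (X → ℝ)} {E : A →ₗ[ℝ] A →ₗ[ℝ] ℝ} {hA : ∀ f ∈ A, MemLp f 2 m}
    {F : (X → ℝ) → (X → ℝ) → ℝ} (hF : ∀ f g : A, F f g = E f g)
    (hcl : QClosable E (toL2 A hA)) : IsClosableIn m (A : Set (X → ℝ)) F := by
  refine ⟨hA, fun u hu hc h0 => ?_⟩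
  lift u to ℕ → A using hu
  have h1 := hcl u ⟨fun ε hε => ?_, toL2_tendsto_iff.2 (h0.congr fun n => eLpNorm_congr_ae ?_)⟩
  · simpa only [hF] using h1
  · obtain ⟨N, hN⟩ := hc ε hε
    exact ⟨N, fun i hi j hj => (hF (u i - u j) (u i - u j)).symm.trans_lt (hN i hi j hj)⟩
  · filter_upwards [Lp.coeFn_zero ℝ 2 m] with x hx
    exact (sub_eq_self.2 hx).symm

theorem isApproximating_iff_qApprox {X : Type*} {mX : MeasurableSpace X} {m : Measure X}
    {A : Submodule ℝ (X → ℝ)} {E : A →ₗ[ℝ] A →ₗ[ℝ] ℝ} {hA : ∀ f ∈ A, MemLp f 2 m}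
    {F : (X → ℝ) → (X → ℝ) → ℝ} (hF : ∀ f g : A, F f g = E f g) {u : ℕ → X → ℝ} {v : Lp ℝ 2 m} :
    IsApproximating m (A : Set (X → ℝ)) F u v ↔
      ∃ w : ℕ → A, (∀ n, u n = w n) ∧ QApprox E (toL2 A hA) w v := by
  have h : ∀ w : ℕ → A, FormCauchy F (fun n => (w n : X → ℝ)) ↔ QCauchy E w := fun w => by
    have h : ∀ i j, F ((w i : X → ℝ) - w j) (w i - w j) = E (w i - w j) (w i - w j) :=
      fun i j => hF (w i - w j) (w i - w j)
    simp only [FormCauchy, QCauchy, h]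
  constructor
  · rintro ⟨h1, h2, h3⟩
    lift u to ℕ → A using h1
    exact ⟨u, fun _ => rfl, (h u).1 h2, toL2_tendsto_iff.2 h3⟩
  · rintro ⟨w, h1, h2, h3⟩
    obtain rfl : u = fun n => (w n : X → ℝ) := funext h1
    exact ⟨fun n => (w n).2, (h w).2 h2, toL2_tendsto_iff.1 h3⟩

theorem isClosureOf_of_qApprox {X : Type*} {mX : MeasurableSpace X} {m : Measure X}
    {A : Submodule ℝ (X → ℝ)} {E : A →ₗ[ℝ] A →ₗ[ℝ] ℝ} {hA : ∀ f ∈ A, MemLp f 2 m}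
    {F : (X → ℝ) → (X → ℝ) → ℝ} (hF : ∀ f g : A, F f g = E f g) {D : DirichletForm m}
    (h1 : ∀ v, v ∈ D.domain ↔ ∃ u, QApprox E (toL2 A hA) u v)
    (h2 : ∀ (v w : D.domain) (f g : ℕ → A), QApprox E (toL2 A hA) f v →
      QApprox E (toL2 A hA) g w → Tendsto (fun n => E (f n) (g n)) atTop (𝓝 (D.form v w))) :
    D.IsClosureOf (A : Set (X → ℝ)) F := by
  refine ⟨fun v => ?_, fun v w f g hf hg => ?_⟩
  · rw [h1]
    constructor
    · rintro ⟨u, hu⟩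
      exact ⟨_, (isApproximating_iff_qApprox hF).2 ⟨u, fun _ => rfl, hu⟩⟩
    · rintro ⟨u, hu⟩
      obtain ⟨w, -, hw⟩ := (isApproximating_iff_qApprox (hA := hA) hF).1 hu
      exact ⟨w, hw⟩
  · obtain ⟨f', hf1, hf⟩ := (isApproximating_iff_qApprox (hA := hA) hF).1 hf
    obtain ⟨g', hg1, hg⟩ := (isApproximating_iff_qApprox (hA := hA) hF).1 hg
    simpa only [hf1, hg1, hF] using h2 v w f' g' hf hg

/-- Convergence of a subsequence almost everywhere. -/
theorem exists_subseq_ae_tendsto_zero {X : Type*} {mX : MeasurableSpace X} {m : Measure X}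
    {A : Submodule ℝ (X → ℝ)} {hA : ∀ f ∈ A, MemLp f 2 m} {u : ℕ → A}
    (hu : Tendsto (fun n => toL2 A hA (u n)) atTop (𝓝 0)) :
    ∃ ns : ℕ → ℕ, StrictMono ns ∧
      ∀ᵐ x ∂m, Tendsto (fun i => (u (ns i) : X → ℝ) x) atTop (𝓝 0) := by
  have h := tendstoInMeasure_of_tendsto_eLpNorm (f := fun n => (u n : X → ℝ))
    (g := ((0 : Lp ℝ 2 m) : X → ℝ)) two_ne_zero (fun n => (hA _ (u n).2).1)
    (Lp.aestronglyMeasurable _) (toL2_tendsto_iff.1 hu)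
  obtain ⟨ns, hns, hlim⟩ := h.exists_seq_tendsto_ae
  refine ⟨ns, hns, ?_⟩
  filter_upwards [hlim, Lp.coeFn_zero ℝ 2 m] with x h1 h2
  rwa [h2] at h1

theorem memLp_of_measurable_of_bdd {X : Type*} {mX : MeasurableSpace X} {m : Measure X}
    [IsFiniteMeasure m] {f : X → ℝ} (hf : Measurable f) (hb : ∃ C, ∀ x, |f x| ≤ C) :
    MemLp f 2 m := by
  obtain ⟨C, hC⟩ := hb
  exact MemLp.of_bound hf.aestronglyMeasurable C (ae_of_all _ hC)

/-! ### The Beurling–Deny decomposition as input -/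

/-- Neither `χ(x)` nor `χ(y)` is known to be measurable for the σ-algebra generated by tensors
vanishing on the diagonal, and constants need not lie in `ℬ`. With `w = f(x) - f(y)` only products
such as `χ(x) χ(y) w` are available, and `w` is recovered as `(x y w)³ / ((x² y w) (x y² w))`. Where
`w = 0`, division by zero gives the correct value. -/
theorem measurable_div_of_ne_zero {Z : Type*} {mZ : MeasurableSpace Z} {x y w h : Z → ℝ}
    (hx : ∀ z, x z ≠ 0) (hy : ∀ z, y z ≠ 0)
    (h1 : Measurable fun z => x z * y z * w z) (h2 : Measurable fun z => x z * x z * y z * w z)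
    (h3 : Measurable fun z => x z * (y z * y z) * w z)
    (h4 : Measurable fun z => h z * (x z * y z) * w z) :
    Measurable w ∧ Measurable fun z => h z * w z := by
  have hw : Measurable w := by
    have : w = fun z => (x z * y z * w z) ^ 3 /
        ((x z * x z * y z * w z) * (x z * (y z * y z) * w z)) := by
      ext z
      have := hx z
      have := hy z
      by_cases hz : w z = 0
      · simp [hz]
      · field_simp
    rw [this]
    exact (h1.pow_const 3).div (h2.mul h3)
  refine ⟨hw, ?_⟩
  have : (fun z => h z * w z) = fun z => h z * (x z * y z) * w z / (x z * y z * w z) * w z := by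
    ext z
    have := hx z
    have := hy z
    by_cases hz : w z = 0
    · simp [hz]
    · field_simp
  rw [this]
  exact (h4.div h1).mul hw

namespace DirichletForm

variable {X : Type*} {mX : MeasurableSpace X} {μ : Measure X} {D : DirichletForm μ}

/-- This function is the tensor `(p f) ⊗ q - p ⊗ (q f)`, which vanishes on the diagonal, so it is
one of the generators. -/
theorem measurable_tensorDiag {p q f : X → ℝ} (hp : p ∈ D.boundedAlgebra)
    (hq : q ∈ D.boundedAlgebra) (hf : f ∈ D.boundedAlgebra) :
    Measurable[D.sigmaTensorDiag] fun z : X × X => p z.1 * q z.2 * (f z.1 - f z.2) := by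
  rw [measurable_iff_comap_le]
  refine le_iSup₂_of_le (fun z : X × X => p z.1 * q z.2 * (f z.1 - f z.2)) ?_ le_rfl
  refine ⟨⟨2, ![p * f, -p], ![q, q * f], ?_, ?_, ?_⟩, fun x => by simp⟩
  · intro i
    fin_cases i
    · exact mul_mem hp hf
    · exact D.boundedSubmodule.neg_mem hp
  · intro i
    fin_cases i
    · exact hq
    · exact mul_mem hq hf
  · intro z
    simp [Fin.sum_univ_two]
    ring

theorem IsBeurlingDeny.isDecomposition {Γc : (X → ℝ) → (X → ℝ) → @SignedMeasure X D.sigmaB}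
    {J : Measure[D.sigmaTensorDiag] (X × X)} {κ : Measure[D.sigmaB] X}
    (hD : D.IsBeurlingDeny Γc J κ) {χ : X → ℝ} (hχ : χ ∈ D.boundedAlgebra) (hχ0 : ∀ x, χ x ≠ 0) :
    IsDecomposition D.boundedSubmodule D.energyForm Γc J Prod.fst Prod.snd κ where
  isLocalForm :=
    { measurable := fun f hf => measurable_sigmaB hf
      bdd := fun f hf => hf.2.1
      mul_mem := fun f hf g hg => mul_mem hf hg
      symm := hD.local_symm
      add := hD.local_add
      smul := hD.local_smul
      nonneg := hD.local_nonneg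
      mul := hD.local_mul }
  generated := rfl
  jump_measurable f hf :=
    (measurable_div_of_ne_zero (mZ := D.sigmaTensorDiag) (h := fun z : X × X => χ z.1)
      (fun z => hχ0 z.1) (fun z => hχ0 z.2)
      (measurable_tensorDiag hχ hχ hf) (measurable_tensorDiag (mul_mem hχ hχ) hχ hf)
      (measurable_tensorDiag hχ (mul_mem hχ hχ) hf)
      (by simpa only [Pi.mul_apply, mul_assoc] using
        measurable_tensorDiag (mul_mem hχ hχ) hχ hf)).1
  jump_measurable_left f hf h hh :=
    (measurable_div_of_ne_zero (mZ := D.sigmaTensorDiag) (h := fun z : X × X => h z.1)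
      (fun z => hχ0 z.1) (fun z => hχ0 z.2)
      (measurable_tensorDiag hχ hχ hf) (measurable_tensorDiag (mul_mem hχ hχ) hχ hf)
      (measurable_tensorDiag hχ (mul_mem hχ hχ) hf)
      (by simpa only [Pi.mul_apply, mul_assoc] using
        measurable_tensorDiag (mul_mem hh hχ) hχ hf)).2
  jump_measurable_right f hf h hh :=
    (measurable_div_of_ne_zero (mZ := D.sigmaTensorDiag) (h := fun z : X × X => h z.2)
      (fun z => hχ0 z.1) (fun z => hχ0 z.2)
      (measurable_tensorDiag hχ hχ hf) (measurable_tensorDiag (mul_mem hχ hχ) hχ hf)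
      (measurable_tensorDiag hχ (mul_mem hχ hχ) hf)
      (by simpa only [Pi.mul_apply, mul_assoc, mul_left_comm] using
        measurable_tensorDiag hχ (mul_mem hh hχ) hf)).2
  jump_integrable := hD.jump_finite
  kill_integrable := hD.kill_integrable
  decomp f g := by
    rw [← D.energy_coe]
    exact hD.decomp f f.2 g g.2

/-- Energy dominance speaks about every measure that satisfies the energy identity; the existence of
one such measure, with known null sets, gives it content. -/
theorem isDominatedBy_of_energyDominant
    {Γc : (X → ℝ) → (X → ℝ) → @SignedMeasure X D.sigmaB}
    {J : Measure[D.sigmaTensorDiag] (X × X)} {κ m : Measure[D.sigmaB] X}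
    (hD : IsDecomposition D.boundedSubmodule D.energyForm Γc J Prod.fst Prod.snd κ)
    (hm : D.EnergyDominant m) :
    IsDominatedBy D.boundedSubmodule Γc J Prod.fst Prod.snd κ m := by
  intro f hf N hN hN0
  obtain ⟨ν, hν, h1, h2⟩ := hD.exists_energyMeasure hf
  refine h2 N hN (hm f hf ν ⟨hν, fun h hh => ?_⟩ hN0)
  rw [D.energy_eq (mul_mem hf hh) hf, D.energy_eq (mul_mem hf hf) hh]
  exact h1 h hh

/-- Because `χ ∈ L²(μ)`, uniform smallness relative to `χ` means convergence to zero in `L²(μ)`,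
even if `μ` is infinite. Closedness of the given Dirichlet form then applies. -/
theorem tendsto_energyForm_zero {χ : X → ℝ} (hχ : χ ∈ D.boundedAlgebra)
    (w : ℕ → D.boundedSubmodule) (hw : QCauchy D.energyForm w)
    (hwχ : ∀ n x, |(w n : X → ℝ) x| ≤ 1 / (n + 1 : ℝ) * |χ x|) :
    Tendsto (fun n => D.energyForm (w n) (w n)) atTop (𝓝 0) := by
  have hlim : Tendsto (fun n => (D.toDomain (w n) : Lp ℝ 2 μ)) atTop (𝓝 0) := by
    have hb := (tendsto_one_div_add_atTop_nhds_zero_nat (𝕜 := ℝ)).mul_const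
      ‖(D.toDomain ⟨χ, hχ⟩ : Lp ℝ 2 μ)‖
    rw [zero_mul] at hb
    refine squeeze_zero_norm (fun n => ?_) hb
    apply Lp.norm_le_mul_norm_of_ae_le_mul
    filter_upwards [D.coe_toDomain (w n), D.coe_toDomain ⟨χ, hχ⟩] with x h1 h2
    rw [h1, h2]
    exact hwχ n x
  obtain ⟨h0, h⟩ := D.closed (fun n => D.toDomain (w n)) 0
    (by simp only [← map_sub]; exact hw) hlim
  have h1 : (⟨0, h0⟩ : D.domain) = 0 := rfl
  simp only [h1, sub_zero] at h
  exact h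

theorem qClosable_energyForm {m : Measure[D.sigmaB] X} [IsFiniteMeasure m]
    (hχ : ∃ χ ∈ D.boundedAlgebra, ∀ x, χ x ≠ 0) (hBD : D.HasBeurlingDeny)
    (hm : D.EnergyDominant m) (hA : ∀ f ∈ D.boundedSubmodule, MemLp f 2 m) :
    QClosable D.energyForm (toL2 (mX := D.sigmaB) (m := m) D.boundedSubmodule hA) := by
  obtain ⟨χ, hχ, hχ0⟩ := hχ
  obtain ⟨Γc, J, κ, hBD⟩ := hBD
  have hD := hBD.isDecomposition hχ hχ0
  intro u hu
  obtain ⟨ns, hns, hlim⟩ := exists_subseq_ae_tendsto_zero hu.2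
  exact hu.1.tendsto_zero_of_subseq D.energyForm_isPosForm hns.tendsto_atTop
    (hD.tendsto_energy_zero (isDominatedBy_of_energyDominant hD hm) D.energyForm_isPosForm hχ hχ0
      (tendsto_energyForm_zero hχ) (hu.1.comp hns.tendsto_atTop) hlim)

end DirichletForm

theorem theorem3p3 {X : Type*} {mX : MeasurableSpace X} (μ : Measure X) [SigmaFinite μ]
    (D : DirichletForm μ)
    (hχ : ∃ χ ∈ D.boundedAlgebra, ∀ x, χ x ≠ 0)
    (hBD : D.HasBeurlingDeny)
    (m : Measure[D.sigmaB] X) [IsFiniteMeasure m]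
    (hm : D.EnergyDominant m) :
    IsClosableIn m D.boundedAlgebra D.energy ∧
      ∃ Dm : DirichletForm m, Dm.IsClosureOf D.boundedAlgebra D.energy := by
  have hA : ∀ f ∈ D.boundedSubmodule, MemLp f 2 m := fun f hf =>
    memLp_of_measurable_of_bdd (DirichletForm.measurable_sigmaB hf) hf.2.1
  have hcl := DirichletForm.qClosable_energyForm hχ hBD hm hA
  have hdense := dense_range_toL2 (mX := D.sigmaB) (m := m) hA rfl
    (fun f hf g hg => DirichletForm.mul_mem hf hg) (fun f hf => hf.2.1)
    (fun f hf c hc => by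
      obtain ⟨g, hg, -⟩ := D.exists_contraction ⟨f, hf⟩ hc
      have h : (fun x => min (max (f x) 0) c) = g := funext fun x => (hg x).symm
      rw [h]
      exact g.2) hχ
  obtain ⟨Dm, h1, h2⟩ := exists_dirichletForm_closure (mX := D.sigmaB) (m := m)
    D.energyForm_isPosForm hA hdense (fun f => D.exists_contraction f zero_le_one) hcl
  exact ⟨isClosableIn_of_qClosable (mX := D.sigmaB) (m := m) D.energy_coe hcl, Dm,
    isClosureOf_of_qApprox (mX := D.sigmaB) (m := m) D.energy_coe h1 h2⟩
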